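/- Let $\mathbb K$ be a field, let $c\ge 1$ and $n\ge 0$ be integers, $R=\mathbb K[x_1,\dots,x_n]$ and $m_R=(x_1,\dots,x_n)$. A $c$-chain of length $s$ is a sequence $a=(a_1,\dots,a_s)$ in $\{1,\dots,n\}$ with $a_i+c<a_{i+1}$ for $1\le i<s$; put $x_a=x_{a_1}\cdots x_{a_s}$. Let $J_s\subseteq R$ be the ideal generated by the monomials $x_a$ for all $c$-chains $a$ of length $s$. Let $t_1,\dots,t_k$ be integers (not necessarily distinct) with $1\le t_i\le\lfloor\frac{n+c}{c+1}\rfloor$, let $\operatorname{Rees}(J_{t_1},\dots,J_{t_k})=\bigoplus_{\alpha\in\mathbb N^k}J_{t_1}^{\alpha_1}\cdots J_{t_k}^{\alpha_k}\,T_1^{\alpha_1}\cdots T_k^{\alpha_k}\subseteq R[T_1,\dots,T_k]$, and let $\mathbb K[Y]$ be the polynomial ring in the variables $Y_{(i,a)}$, where $1\le i\le k$ and $a$ is a $c$-chain of length $t_i$. Consider the $\mathbb K$-algebra homomorphism $$\Psi:\mathbb K[Y]\to \operatorname{Rees}(J_{t_1},\dots,J_{t_k})/m_R\operatorname{Rees}(J_{t_1},\dots,J_{t_k}),\qquad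 Y_{(i,a)}\mapsto x_aT_i,$$ and let $I_\Psi\subseteq\mathbb K[Y]$ be the ideal generated by all binomials $Y_{(i_1,a^{(1)})}\cdots Y_{(i_d,a^{(d)})}-Y_{(i_1,b^{(1)})}\cdots Y_{(i_d,b^{(d)})}$ $(d\ge 0)$ such that the multiset of all entries of $a^{(1)},\dots,a^{(d)}$ equals that of $b^{(1)},\dots,b^{(d)}$. For a $c$-chain $a=(a_1,\dots,a_s)$ let $L(a)=\bigcup_{i=2}^s[a_i-c,a_i]$. A pair $(a,b)$ of $c$-chains of lengths $s$ and $r$ is quasi-sorted if $x_a\ge x_b$ in the degree lexicographic order with $x_1>\cdots>x_n$, if $a_i\le b_i$ for $1\le i\le r$, and if for all $i\le r$ with $i<s$ and $b_i>a_{i+1}$ one has $b_i,b_{i+1},\dots,b_r\in L(a)$. A monomial of $\mathbb K[Y]$ is quasi-sorted if its factors, counted with multiplicity, can be listed as $Y_{(i_1,a^{(1)})},\dots,Y_{(i_d,a^{(d)})}$ so that for all $p<q$ the pair $(a^{(p)},a^{(q)})$ is quasi-sorted and, if $t_{i_p}=t_{i_q}$, then $i_p\le i_q$. Theorem. The map $\Psi$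 is surjective with kernel $I_\Psi$, and there is a term order $\prec$ on $\mathbb K[Y]$ such that: 1. the $\prec$-standard monomials modulo $I_\Psi$, that is, the monomials not in $\operatorname{in}_\prec(I_\Psi)$, are exactly the quasi-sorted monomials; 2. $\operatorname{in}_\prec(I_\Psi)$ is generated by squarefree quadratic monomials; 3. $I_\Psi$, the defining ideal of the special fiber $\operatorname{Rees}(J_{t_1},\dots,J_{t_k})/m_R\operatorname{Rees}(J_{t_1},\dots,J_{t_k})$, has a finite Gröbner basis with respect to $\prec$ that consists of homogeneous polynomials of degree $2$. -/

import Mathlib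

noncomputable section

namespace QuasiSorted

open MvPolynomial

/-- The `c`-chains of length `s` in the index set of the variables. The indices `1, …, n` are
represented by `Fin n`, and a sequence `a` is a `c`-chain when `a i + c < a j` for `i < j`. -/
abbrev CChain (c n s : ℕ) : Type :=
  {a : Fin s → Fin n // ∀ i j : Fin s, i < j → (a i : ℕ) + c < (a j : ℕ)}

/-- The index set of the variables `Y_(i, a)`: here `i : Fin k` and `a` is a `c`-chain of
length `t i`. -/
abbrev YVar (c n : ℕ) {k : ℕ} (t : Fin k → ℕ) : Type := Σ i : Fin k, CChain c n (t i)

section Chains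

variable {c n s r : ℕ}

/-- The multiset of the entries of a chain. -/
def entries (a : CChain c n s) : Multiset (Fin n) := Finset.univ.val.map a.1

/-- The exponent vector of the monomial `x_a = x_{a_1} ⋯ x_{a_s}`. -/
def chainExponent (a : CChain c n s) : Fin n →₀ ℕ := ∑ i, Finsupp.single (a.1 i) 1

/-- `x_a ≥ x_b` in the degree lexicographic order with `x_1 > x_2 > ⋯ > x_n`. -/
def ChainGE (a : CChain c n s) (b : CChain c n r) : Prop :=
  MonomialOrder.degLex.toSyn (chainExponent b) ≤ MonomialOrder.degLex.toSyn (chainExponent a)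

/-- The union `L(a)` of the intervals `[a_i - c, a_i]` over all positions `i` except the first. -/
def intervalUnion (a : CChain c n s) : Set ℕ :=
  {x | ∃ i : Fin s, 0 < (i : ℕ) ∧ (a.1 i : ℕ) ≤ x + c ∧ x ≤ (a.1 i : ℕ)}

/-- The pair of rows `(a, b)` is quasi-sorted: `x_a ≥ x_b`, the columns weakly increase, and as
soon as `b_i > a_{i+1}` (where `a_{i+1}` exists) all of `b_i, b_{i+1}, …` lie in `L(a)`. -/
def QuasiSortedPair (a : CChain c n s) (b : CChain c n r) : Prop :=
  ChainGE a b ∧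
  (∀ (i : Fin s) (j : Fin r), (i : ℕ) = (j : ℕ) → a.1 i ≤ b.1 j) ∧
  (∀ (i : Fin s) (j : Fin r), (i : ℕ) = (j : ℕ) + 1 → a.1 i < b.1 j →
    ∀ l : Fin r, j ≤ l → (b.1 l : ℕ) ∈ intervalUnion a)

end Chains

section Monomials

variable {c n k : ℕ} {t : Fin k → ℕ}

/-- A monomial in the `Y`-variables is quasi-sorted if its factors, with multiplicity, are the rows
`p 0, p 1, …` of a quasi-sorted table, where rows of the same length that carry different labels
are listed in the order of their labels. -/
def QuasiSortedMonomial (u : YVar c n t →₀ ℕ) : Prop :=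
  ∃ (d : ℕ) (p : Fin d → YVar c n t),
    u = ∑ e, Finsupp.single (p e) 1 ∧
    ∀ e f : Fin d, e < f →
      QuasiSortedPair (p e).2 (p f).2 ∧ (t (p e).1 = t (p f).1 → (p e).1 ≤ (p f).1)

end Monomials

section GroebnerBases

variable {σ K : Type*} [Field K]

/-- The initial ideal of `I`. -/
def initialIdeal (m : MonomialOrder σ) (I : Ideal (MvPolynomial σ K)) :
    Ideal (MvPolynomial σ K) :=
  Ideal.span {g | ∃ f ∈ I, f ≠ 0 ∧ g = monomial (m.degree f) 1}

/-- The monomial with exponent vector `u` is standard modulo `I`. -/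
def IsStandard (m : MonomialOrder σ) (I : Ideal (MvPolynomial σ K)) (u : σ →₀ ℕ) : Prop :=
  monomial u (1 : K) ∉ initialIdeal m I

/-- `G` is a (finite) Gröbner basis of `I`. -/
def IsGroebnerBasis (m : MonomialOrder σ) (I : Ideal (MvPolynomial σ K))
    (G : Finset (MvPolynomial σ K)) : Prop :=
  (∀ g ∈ G, g ∈ I ∧ g ≠ 0) ∧
  initialIdeal m I = Ideal.span {h | ∃ g ∈ G, h = monomial (m.degree g) 1}

end GroebnerBases

/-- The multi-homogeneous Rees algebra `⨁ (I_1 T_1)^{α_1} ⋯ (I_k T_k)^{α_k}`, as the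
`R`-subalgebra of `R[T_1, …, T_k]` of the polynomials whose `T^α`-coefficient lies in
`I_1^{α_1} ⋯ I_k^{α_k}` for every `α`. -/
def multiRees {R : Type*} [CommRing R] {k : ℕ} (I : Fin k → Ideal R) :
    Subalgebra R (MvPolynomial (Fin k) R) where
  carrier := {f | ∀ α : Fin k →₀ ℕ, coeff α f ∈ ∏ i, I i ^ α i}
  mul_mem' := by
    intro f g hf hg α
    rw [coeff_mul]
    refine Ideal.sum_mem _ fun x hx => ?_
    have h := Ideal.mul_mem_mul (hf x.1) (hg x.2)
    rw [← Finset.prod_mul_distrib] at h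
    have hα : x.1 + x.2 = α := Finset.HasAntidiagonal.mem_antidiagonal.mp hx
    subst hα
    simpa [pow_add] using h
  add_mem' := by
    intro f g hf hg α
    rw [coeff_add]
    exact Ideal.add_mem _ (hf α) (hg α)
  algebraMap_mem' := by
    intro x α
    rw [algebraMap_eq, coeff_C]
    split_ifs with h
    · subst h
      simp [-Ideal.one_eq_top]
    · exact Ideal.zero_mem _

/-- The ideal of `Rees(I_1, …, I_k)` generated by the ideal `M` of `R`. -/
abbrev fiberIdeal {R : Type*} [CommRing R] {k : ℕ} (M : Ideal R) (I : Fin k → Ideal R) :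
    Ideal (multiRees I) :=
  M.map (algebraMap R (multiRees I))

section SpecialFiber

variable (K : Type*) [Field K] (c n : ℕ)

/-- The monomial `x_a`. -/
def chainMonomial {c n s : ℕ} (a : CChain c n s) : MvPolynomial (Fin n) K := ∏ i, X (a.1 i)

/-- The ideal `J_s` of `K[x_1, …, x_n]` generated by the monomials `x_a`, where `a` is a
`c`-chain of length `s`. -/
def chainIdeal (s : ℕ) : Ideal (MvPolynomial (Fin n) K) :=
  Ideal.span (Set.range fun a : CChain c n s => chainMonomial K a)

/-- The special fiber `Rees(J_{t_1}, …, J_{t_k}) / (x_1, …, x_n) Rees(J_{t_1}, …, J_{t_k})`. -/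
abbrev SpecialFiber {k : ℕ} (t : Fin k → ℕ) : Type _ :=
  multiRees (fun i => chainIdeal K c n (t i)) ⧸
    fiberIdeal (Ideal.span (Set.range (X : Fin n → MvPolynomial (Fin n) K)))
      (fun i => chainIdeal K c n (t i))

variable {k : ℕ} (t : Fin k → ℕ)

variable {c n t}

/-- The element `x_a T_i` of the Rees algebra, where `y = (i, a)`. -/
def reesGenerator (y : YVar c n t) : multiRees (fun i => chainIdeal K c n (t i)) :=
  ⟨monomial (Finsupp.single y.1 1) (chainMonomial K y.2), by
    intro α
    rw [coeff_monomial]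
    split_ifs with h
    · subst h
      rw [Finset.prod_eq_single y.1]
      · simpa [chainIdeal] using Ideal.subset_span (Set.mem_range_self y.2)
      · intro j _ hj
        simp [Finsupp.single_eq_of_ne hj]
      · simp
    · exact Ideal.zero_mem _⟩

variable (c n t)

/-- The `K`-algebra homomorphism `Ψ` from `K[Y]` to the special fiber, `Y_(i, a) ↦ x_a T_i`. -/
def Psi : MvPolynomial (YVar c n t) K →ₐ[K] SpecialFiber K c n t :=
  aeval fun y => Ideal.Quotient.mk _ (reesGenerator K y)

/-- The toric ideal `I_Ψ`, generated by the binomials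
`Y_(i_1, a^(1)) ⋯ Y_(i_d, a^(d)) - Y_(i_1, b^(1)) ⋯ Y_(i_d, b^(d))`, with `d ≥ 0`, such that
the chains `a^(1), …, a^(d)` and `b^(1), …, b^(d)` together have the same multiset of entries. -/
def toricIdeal : Ideal (MvPolynomial (YVar c n t) K) :=
  Ideal.span {f | ∃ (d : ℕ) (p q : Fin d → YVar c n t),
    (∀ e, (p e).1 = (q e).1) ∧
    (∑ e, entries (p e).2 = ∑ e, entries (q e).2) ∧
    f = ∏ e, X (p e) - ∏ e, X (q e)}

end SpecialFiber

end QuasiSorted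

end

/-!
A monomial of `K[Y]` is a table whose rows are chains with labels, and its *fiber* consists of the
tables with the same labels and the same entries. Modulo the toric ideal all tables of a fiber
agree, so everything follows once there is a monomial order for which the quasi-sorted tables are
the smallest elements of the fibers, and for which a table that is not quasi-sorted can be made
smaller by changing just two of its rows. This rests on two facts.

*A fiber contains at most one quasi-sorted table* (`quasiSorted_unique`). The table can be recovered
by reading its entries downwards from the largest one. When it comes to the occurrences of `y`, a
row can receive `y` only if it has no entry in `[y, y + c]` yet. The conditions on pairs of rows say
that, among the rows that can receive `y`, those with the largest number of entries still to be
filled do, and that ties are won by the lower row (`QuasiSortedPair.countLE_le` and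
`QuasiSortedPair.countLE_lt`). So the first difference between two tables would be contradictory.

*A pair of rows that is not quasi-sorted can be made smaller*
(`reduciblePair_of_not_quasiSortedRel`). The order `tableOrder` compares, for `x = 1, 2, …` in
turn, the sums of the positions at which `x` occurs in the rows. If the columns weakly increase
but the condition on `L(a)` fails, then a segment of `b` can be exchanged with a segment of `a`
further to the right, so that the first entry involved moves to an earlier position
(`exists_segmentSwap`). If the columns do not weakly increase, sorting them (`exists_columnSort`)
does not affect the positions, but lowers the sum of the entries of one row and raises that of the
other one. A strictly concave function of these sums detects this, once the sums have been shifted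
according to the labels so that the row listed first has the smaller value (`concaveWeight`).

Since being quasi-sorted is a condition on pairs of factors (`quasiSortedMonomial_of_pairs`), the
smallest table of a fiber is quasi-sorted, hence it is the only quasi-sorted one. The binomials of
the pairs that are not quasi-sorted are then a Gröbner basis. The kernel of `Ψ` is the toric ideal
because the ideals `J_t` are generated in a single degree: elements of `m_R Rees` have coefficients
of larger degree (`ker_Psi`).
-/

namespace QuasiSorted

/-! ### Chains -/

section Chains

variable {c n s r : ℕ}

theorem CChain.strictMono (a : CChain c n s) : StrictMono a.1 := fun i j hij =>
  Fin.lt_def.2 (by have := a.2 i j hij; omega)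

theorem chainExponent_apply (a : CChain c n s) (y : Fin n) [Decidable (∃ i, a.1 i = y)] :
    chainExponent a y = if ∃ i, a.1 i = y then 1 else 0 := by
  rw [chainExponent, Finsupp.finsetSum_apply]
  split_ifs with h
  · obtain ⟨i, rfl⟩ := h
    rw [Finset.sum_eq_single i]
    · simp
    · intro j _ hj
      rw [Finsupp.single_apply, if_neg fun h => hj (a.strictMono.injective h)]
    · simp
  · refine Finset.sum_eq_zero fun j _ => ?_
    rw [Finsupp.single_apply, if_neg fun hj => h ⟨j, hj⟩]

theorem degree_chainExponent (a : CChain c n s) : (chainExponent a).degree = s := by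
  simp [chainExponent]

theorem CChain.ext_of_exists_iff {a b : CChain c n s}
    (h : ∀ y, (∃ i, a.1 i = y) ↔ ∃ i, b.1 i = y) : a = b :=
  Subtype.ext ((a.strictMono.range_inj b.strictMono).1 (Set.ext h))

theorem chainExponent_injective :
    Function.Injective (chainExponent : CChain c n s → Fin n →₀ ℕ) := by
  classical
  intro a b h
  refine CChain.ext_of_exists_iff fun y => ?_
  have := DFunLike.congr_fun h y
  rw [chainExponent_apply, chainExponent_apply] at this
  split_ifs at this <;> simp_all

theorem toFinsupp_entries (a : CChain c n s) :
    Multiset.toFinsupp (entries a) = chainExponent a := by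
  have : entries a = ∑ i, {a.1 i} := by
    rw [entries, ← Multiset.sum_map_singleton (Finset.univ.val.map a.1), Multiset.map_map]
    rfl
  rw [this, map_sum, chainExponent]
  simp

theorem length_le_of_chainGE {a : CChain c n s} {b : CChain c n r} (h : ChainGE a b) :
    r ≤ s := by
  rw [ChainGE, MonomialOrder.degLex_le_iff, Finsupp.DegLex.le_iff] at h
  simp only [ofDegLex_toDegLex, degree_chainExponent] at h
  omega

/-- For a longer or equally long first row, weakly increasing columns force the degree
lexicographic comparison of the two rows. -/
theorem chainGE_of_le {a : CChain c n s} {b : CChain c n r} (hrs : r ≤ s)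
    (h : ∀ (i : Fin s) (j : Fin r), (i : ℕ) = (j : ℕ) → a.1 i ≤ b.1 j) : ChainGE a b := by
  classical
  rw [ChainGE, MonomialOrder.degLex_le_iff, Finsupp.DegLex.le_iff]
  simp only [ofDegLex_toDegLex, degree_chainExponent]
  rcases hrs.lt_or_eq with hlt | rfl
  · exact Or.inl hlt
  refine Or.inr ⟨rfl, ?_⟩
  by_cases hab : a = b
  · rw [hab]
  have hex : ∃ i, a.1 i ≠ b.1 i := by
    by_contra! hc
    exact hab (Subtype.ext (funext hc))
  obtain ⟨i, hi, hmin⟩ := WellFounded.has_min (wellFounded_lt (α := Fin r)) {i | a.1 i ≠ b.1 i} hex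
  have hmin' : ∀ j, j < i → a.1 j = b.1 j := fun j hj => by
    by_contra hc
    exact hmin j hc hj
  have hlt : a.1 i < b.1 i := lt_of_le_of_ne (h i i rfl) hi
  refine le_of_lt (Finsupp.Lex.lt_iff.2 ⟨a.1 i, fun y hy => ?_, ?_⟩)
  · simp only [ofLex_toLex, chainExponent_apply]
    congr 1
    refine propext ⟨?_, ?_⟩
    · rintro ⟨j, rfl⟩
      exact ⟨j, hmin' j (b.strictMono.lt_iff_lt.1 (hy.trans hlt))⟩
    · rintro ⟨j, rfl⟩
      exact ⟨j, (hmin' j (a.strictMono.lt_iff_lt.1 hy)).symm⟩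
  · simp only [ofLex_toLex, chainExponent_apply]
    rw [if_neg, if_pos ⟨i, rfl⟩]
    · exact Nat.zero_lt_one
    · rintro ⟨j, hj⟩
      rcases lt_or_ge j i with hji | hji
      · rw [← hmin' j hji] at hj
        exact hji.ne (a.strictMono.injective hj)
      · have := b.strictMono.monotone hji
        exact absurd (hj ▸ this) (not_le.2 hlt)

theorem QuasiSortedPair.refl (a : CChain c n s) : QuasiSortedPair a a := by
  refine ⟨le_rfl, fun i j hij => by rw [Fin.ext hij], fun i j hij hlt => ?_⟩
  have := a.strictMono.lt_iff_lt.1 hlt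
  rw [Fin.lt_def] at this
  omega

end Chains

/-! ### Uniqueness of quasi-sorted tables -/

section Uniqueness

variable {c n s r : ℕ}

/-- The number of entries of a chain that are at most `y`. -/
def countLE (a : CChain c n s) (y : Fin n) : ℕ := (Finset.univ.filter fun i => a.1 i ≤ y).card

theorem countLE_apply (a : CChain c n s) (i : Fin s) : countLE a (a.1 i) = i + 1 := by
  rw [countLE]
  simp only [a.strictMono.le_iff_le]
  have : (Finset.univ.filter fun j : Fin s => j ≤ i) = Finset.Iic i := by ext; simp
  rw [this, Fin.card_Iic]

theorem countLE_le_of_forall {a : CChain c n s} {y : Fin n} {m : ℕ}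
    (h : ∀ i, a.1 i ≤ y → (i : ℕ) < m) : countLE a y ≤ m := by
  rw [countLE, ← Finset.card_range m]
  refine Finset.card_le_card_of_injOn (fun i => (i : ℕ)) ?_ (fun i _ j _ hij => Fin.ext hij)
  intro i hi
  simpa using h i (by simpa using hi)

theorem countLE_eq_of_agree {a b : CChain c n s} {y : Fin n}
    (h : ∀ z, y < z → ((∃ i, a.1 i = z) ↔ ∃ i, b.1 i = z)) : countLE a y = countLE b y := by
  classical
  have key : ∀ a : CChain c n s, countLE a y +
      (Finset.univ.filter fun z => y < z ∧ ∃ i, a.1 i = z).card = s := by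
    intro a
    have h1 : (Finset.univ.filter fun z => y < z ∧ ∃ i, a.1 i = z) =
        (Finset.univ.filter fun i => ¬ a.1 i ≤ y).image a.1 := by
      ext z
      simp only [Finset.mem_filter, Finset.mem_univ, true_and, Finset.mem_image, not_le]
      constructor
      · rintro ⟨hz, i, rfl⟩
        exact ⟨i, hz, rfl⟩
      · rintro ⟨i, hz, rfl⟩
        exact ⟨hz, i, rfl⟩
    rw [h1, Finset.card_image_of_injective _ a.strictMono.injective, countLE,
      Finset.card_filter_add_card_filter_not, Finset.card_univ, Fintype.card_fin]
  have ha := key a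
  have hb := key b
  have : (Finset.univ.filter fun z => y < z ∧ ∃ i, a.1 i = z) =
      (Finset.univ.filter fun z => y < z ∧ ∃ i, b.1 i = z) := by
    ext z
    simp only [Finset.mem_filter, Finset.mem_univ, true_and]
    exact and_congr_right fun hz => h z hz
  rw [this] at ha
  omega

/-- If `y` occurs in the lower row `b` of a quasi-sorted pair `(a, b)`, whereas the upper row
could have received `y` as well, then the upper row is not ahead of the lower one at `y`. -/
theorem QuasiSortedPair.countLE_le {a : CChain c n s} {b : CChain c n r}
    (h : QuasiSortedPair a b) {y : Fin n} (hb : ∃ l, b.1 l = y)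
    (ha : ∀ i, (a.1 i : ℕ) < y ∨ (y : ℕ) + c < a.1 i) : countLE a y ≤ countLE b y := by
  obtain ⟨l, rfl⟩ := hb
  rw [countLE_apply]
  refine countLE_le_of_forall fun i hi => ?_
  by_contra! hli
  have hs : (l : ℕ) + 1 < s := lt_of_le_of_lt hli i.2
  have h1 : a.1 ⟨l + 1, hs⟩ ≤ b.1 l := le_trans (a.strictMono.monotone (Fin.le_def.2 hli)) hi
  have h2 : a.1 ⟨l + 1, hs⟩ < b.1 l := by
    refine lt_of_le_of_ne h1 fun he => ?_
    have := ha ⟨l + 1, hs⟩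
    rw [he] at this
    omega
  obtain ⟨q, -, hq1, hq2⟩ := h.2.2 ⟨l + 1, hs⟩ l rfl h2 l le_rfl
  have := ha q
  omega

/-- If `y` occurs in the upper row `a` of a quasi-sorted pair `(a, b)` but not in the lower one,
then the upper row is ahead of the lower one at `y`. -/
theorem QuasiSortedPair.countLE_lt {a : CChain c n s} {b : CChain c n r}
    (h : QuasiSortedPair a b) {y : Fin n} (ha : ∃ l, a.1 l = y) (hb : ∀ i, b.1 i ≠ y) :
    countLE b y < countLE a y := by
  obtain ⟨l, rfl⟩ := ha
  rw [countLE_apply, Nat.lt_succ_iff]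
  refine countLE_le_of_forall fun i hi => ?_
  by_contra! hli
  have hr : (l : ℕ) < r := lt_of_le_of_lt hli i.2
  have h1 : b.1 ⟨l, hr⟩ ≤ a.1 l := le_trans (b.strictMono.monotone (Fin.le_def.2 hli)) hi
  exact hb ⟨l, hr⟩ (le_antisymm h1 (h.2.1 l ⟨l, hr⟩ rfl))

/-- If `b` contains `y` and agrees with `a` above `y`, then there is room for `y` in `a` as well. -/
theorem lt_or_add_lt_of_agree {a b : CChain c n s} {y : Fin n}
    (h : ∀ z, y < z → ((∃ i, a.1 i = z) ↔ ∃ i, b.1 i = z)) (hb : ∃ i, b.1 i = y)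
    (ha : ¬ ∃ i, a.1 i = y) (i : Fin s) : (a.1 i : ℕ) < y ∨ (y : ℕ) + c < a.1 i := by
  rcases lt_trichotomy (a.1 i) y with hlt | heq | hgt
  · exact Or.inl hlt
  · exact absurd ⟨i, heq⟩ ha
  · right
    obtain ⟨j, hj⟩ := (h _ hgt).1 ⟨i, rfl⟩
    obtain ⟨m, rfl⟩ := hb
    rw [← hj] at hgt ⊢
    exact b.2 m j (b.strictMono.lt_iff_lt.1 hgt)

/-- Two quasi-sorted pairs of rows that agree above `y` cannot differ in which of the two rows
receives `y`. -/
theorem false_of_swapped {a a' : CChain c n s} {b b' : CChain c n r} {y : Fin n}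
    (h : QuasiSortedPair a b) (h' : QuasiSortedPair a' b')
    (ha : ∀ z, y < z → ((∃ i, a.1 i = z) ↔ ∃ i, a'.1 i = z))
    (hb : ∀ z, y < z → ((∃ i, b.1 i = z) ↔ ∃ i, b'.1 i = z))
    (hay : ∃ i, a.1 i = y) (hby : ¬ ∃ i, b.1 i = y) (hay' : ¬ ∃ i, a'.1 i = y)
    (hby' : ∃ i, b'.1 i = y) : False := by
  have h1 := h.countLE_lt hay fun i hi => hby ⟨i, hi⟩
  have h2 := h'.countLE_le hby' (lt_or_add_lt_of_agree (fun z hz => (ha z hz).symm) hay hay')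
  rw [countLE_eq_of_agree ha, countLE_eq_of_agree hb] at h1
  omega

/-- A quasi-sorted table is determined by its shape and the multiset of its entries: reading the
entries downwards from the largest one, each entry has to be placed in those rows, among the ones
that can receive it, that have the most entries left to be filled. -/
theorem quasiSorted_unique {d : ℕ} {len : Fin d → ℕ} (A B : ∀ e, CChain c n (len e))
    (hA : ∀ e f, e < f → QuasiSortedPair (A e) (A f))
    (hB : ∀ e f, e < f → QuasiSortedPair (B e) (B f))
    (h : ∑ e, chainExponent (A e) = ∑ e, chainExponent (B e)) : A = B := by
  classical
  have main : ∀ y, ∀ e, (∃ i, (A e).1 i = y) ↔ ∃ i, (B e).1 i = y := by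
    intro y
    induction y using WellFounded.induction (wellFounded_gt (α := Fin n)) with
    | _ y ih =>
    by_contra hne
    have hcard : ∀ A : ∀ e, CChain c n (len e), (∑ e, chainExponent (A e)) y =
        (Finset.univ.filter fun e => ∃ i, (A e).1 i = y).card := by
      intro A
      rw [Finsupp.finsetSum_apply, Finset.card_filter]
      simp only [chainExponent_apply]
    have hc : (Finset.univ.filter fun e => ∃ i, (A e).1 i = y).card =
        (Finset.univ.filter fun e => ∃ i, (B e).1 i = y).card := by
      rw [← hcard, ← hcard, h]
    have hne' : (Finset.univ.filter fun e => ∃ i, (A e).1 i = y) ≠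
        (Finset.univ.filter fun e => ∃ i, (B e).1 i = y) := by
      intro he
      refine hne fun e => ?_
      have := Finset.ext_iff.1 he e
      simpa using this
    obtain ⟨p, hp, hp'⟩ := Finset.not_subset.1 fun hs =>
      hne' (Finset.eq_of_subset_of_card_le hs hc.ge)
    obtain ⟨q, hq, hq'⟩ := Finset.not_subset.1 fun hs =>
      hne' (Finset.eq_of_subset_of_card_le hs hc.le).symm
    simp only [Finset.mem_filter, Finset.mem_univ, true_and] at hp hp' hq hq'
    rcases lt_trichotomy p q with hpq | rfl | hpq
    · exact false_of_swapped (hA p q hpq) (hB p q hpq) (fun z hz => ih z hz p)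
        (fun z hz => ih z hz q) hp hq' hp' hq
    · exact hp' hq
    · exact false_of_swapped (hB q p hpq) (hA q p hpq) (fun z hz => (ih z hz q).symm)
        (fun z hz => (ih z hz p).symm) hq hp' hq' hp
  funext e
  exact CChain.ext_of_exists_iff fun y => main y e

end Uniqueness

/-! ### Exchanging entries of two rows -/

section Exchange

variable {c n s r : ℕ}

/-- The involution of the positions of a pair of rows that exchanges the position `m + δ` of the
first row with the position `m` of the second row for all `m` in `W`. -/
def shiftSwap (s r δ : ℕ) (W : ℕ → Prop) [DecidablePred W] (hs : ∀ m, W m → m + δ < s)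
    (hr : ∀ m, W m → m < r) : Fin s ⊕ Fin r → Fin s ⊕ Fin r
  | .inl k => if h : δ ≤ k ∧ W (k - δ) then .inr ⟨k - δ, hr _ h.2⟩ else .inl k
  | .inr k => if h : W k then .inl ⟨k + δ, hs _ h⟩ else .inr k

theorem shiftSwap_involutive (δ : ℕ) (W : ℕ → Prop) [DecidablePred W]
    (hs : ∀ m, W m → m + δ < s) (hr : ∀ m, W m → m < r) :
    Function.Involutive (shiftSwap s r δ W hs hr) := by
  rintro (k | k)
  · by_cases h : δ ≤ k ∧ W (k - δ)
    · simp [shiftSwap, h]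
    · simp [shiftSwap, h]
  · by_cases h : W k
    · simp [shiftSwap, h]
    · simp [shiftSwap, h]

theorem sum_shiftSwap {M : Type*} [AddCommMonoid M] (δ : ℕ) (W : ℕ → Prop) [DecidablePred W]
    (hs : ∀ m, W m → m + δ < s) (hr : ∀ m, W m → m < r) (F : Fin s ⊕ Fin r → M) :
    ∑ i, F (shiftSwap s r δ W hs hr (.inl i)) + ∑ j, F (shiftSwap s r δ W hs hr (.inr j)) =
      ∑ i, F (.inl i) + ∑ j, F (.inr j) := by
  have := Equiv.sum_comp (shiftSwap_involutive δ W hs hr).toPerm F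
  simpa [Fintype.sum_sum_type] using this

/-- The sum of the positions (counted from `0`) at which `y` occurs in a row. -/
def position (a : CChain c n s) (y : Fin n) : ℕ := ∑ i, if a.1 i = y then (i : ℕ) else 0

/-- The sum of the entries of a row. -/
def entrySum (a : CChain c n s) : ℕ := ∑ i, (a.1 i : ℕ)

/-- The exchange by which two rows are replaced by their columnwise minimum and maximum. -/
theorem exists_columnSort (hrs : r ≤ s) (a : CChain c n s) (b : CChain c n r)
    (h : ∃ (i : Fin s) (j : Fin r), (i : ℕ) = j ∧ b.1 j < a.1 i) :
    ∃ (a' : CChain c n s) (b' : CChain c n r),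
      chainExponent a' + chainExponent b' = chainExponent a + chainExponent b ∧
      (∀ y, position a' y + position b' y = position a y + position b y) ∧
      entrySum a' + entrySum b' = entrySum a + entrySum b ∧
      entrySum a' < entrySum a ∧
      (∀ (i : Fin s) (j : Fin r), s = r → (i : ℕ) = j → a.1 i < b.1 j →
        entrySum a' < entrySum b) := by
  classical
  let W : ℕ → Prop := fun m => ∃ (hs : m < s) (hr : m < r), b.1 ⟨m, hr⟩ < a.1 ⟨m, hs⟩
  have hs' : ∀ m, W m → m + 0 < s := fun m ⟨h, _⟩ => h
  have hr' : ∀ m, W m → m < r := fun m ⟨_, h, _⟩ => h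
  let π := shiftSwap s r 0 W hs' hr'
  let v : Fin s ⊕ Fin r → Fin n := Sum.elim a.1 b.1
  let idx : Fin s ⊕ Fin r → ℕ := Sum.elim (fun k => (k : ℕ)) fun k => (k : ℕ)
  have hidx : ∀ z, idx (π z) = idx z := by
    rintro (k | k) <;> simp only [π, shiftSwap] <;> split_ifs <;> simp [idx]
  have hmin : ∀ (k : Fin s) (h : (k : ℕ) < r), v (π (.inl k)) = min (a.1 k) (b.1 ⟨k, h⟩) := by
    intro k h
    simp only [π, shiftSwap]
    split_ifs with h1
    · obtain ⟨-, h2, h3, h4⟩ := h1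
      exact (min_eq_right h4.le).symm
    · refine (min_eq_left (not_lt.1 fun h2 => h1 ⟨Nat.zero_le _, k.2, h, h2⟩)).symm
  have hself : ∀ k : Fin s, r ≤ k → v (π (.inl k)) = a.1 k := by
    intro k h
    simp only [π, shiftSwap]
    rw [dif_neg]
    · rfl
    · rintro ⟨-, -, h2, -⟩
      simp only [Nat.sub_zero] at h2
      omega
  have hmax : ∀ k : Fin r, v (π (.inr k)) = max (a.1 ⟨k, k.2.trans_le hrs⟩) (b.1 k) := by
    intro k
    simp only [π, shiftSwap]
    split_ifs with h1
    · obtain ⟨h2, h3, h4⟩ := h1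
      exact (max_eq_left h4.le).symm
    · refine (max_eq_right (not_lt.1 fun h2 => h1 ⟨k.2.trans_le hrs, k.2, h2⟩)).symm
  have hle : ∀ k : Fin s, v (π (.inl k)) ≤ a.1 k := by
    intro k
    rcases lt_or_ge (k : ℕ) r with h | h
    · rw [hmin k h]
      exact min_le_left _ _
    · exact (hself k h).le
  have ha' : ∀ k₁ k₂ : Fin s, k₁ < k₂ → (v (π (.inl k₁)) : ℕ) + c < v (π (.inl k₂)) := by
    intro k₁ k₂ hk
    have h0 := a.2 k₁ k₂ hk
    have h1 := Fin.le_def.1 (hle k₁)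
    rw [Fin.lt_def] at hk
    rcases lt_or_ge (k₂ : ℕ) r with h | h
    · rw [hmin k₂ h, hmin k₁ (hk.trans h)]
      have h3 := b.2 ⟨k₁, hk.trans h⟩ ⟨k₂, h⟩ hk
      rcases min_cases (a.1 k₂) (b.1 ⟨k₂, h⟩) with h2 | h2 <;> rw [h2.1]
      · have := Fin.le_def.1 (min_le_left (a.1 k₁) (b.1 ⟨k₁, hk.trans h⟩))
        omega
      · have := Fin.le_def.1 (min_le_right (a.1 k₁) (b.1 ⟨k₁, hk.trans h⟩))
        omega
    · rw [hself k₂ h]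
      omega
  have hb' : ∀ k₁ k₂ : Fin r, k₁ < k₂ → (v (π (.inr k₁)) : ℕ) + c < v (π (.inr k₂)) := by
    intro k₁ k₂ hk
    have h0 := b.2 k₁ k₂ hk
    have h3 := a.2 ⟨k₁, k₁.2.trans_le hrs⟩ ⟨k₂, k₂.2.trans_le hrs⟩ hk
    have h4 := Fin.le_def.1 (le_max_left (a.1 ⟨k₂, k₂.2.trans_le hrs⟩) (b.1 k₂))
    have h5 := Fin.le_def.1 (le_max_right (a.1 ⟨k₂, k₂.2.trans_le hrs⟩) (b.1 k₂))
    rw [hmax, hmax]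
    rcases max_cases (a.1 ⟨k₁, k₁.2.trans_le hrs⟩) (b.1 k₁) with h2 | h2 <;> rw [h2.1] <;> omega
  refine ⟨⟨fun k => v (π (.inl k)), ha'⟩, ⟨fun k => v (π (.inr k)), hb'⟩, ?_, ?_, ?_, ?_, ?_⟩
  · exact sum_shiftSwap 0 W hs' hr' fun z => Finsupp.single (v z) 1
  · intro y
    have := sum_shiftSwap 0 W hs' hr' fun z => if v z = y then idx z else 0
    simp only [show ∀ z, idx (shiftSwap s r 0 W hs' hr' z) = idx z from hidx] at this
    exact this
  · exact sum_shiftSwap 0 W hs' hr' fun z => (v z : ℕ)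
  · obtain ⟨i, j, hij, hlt⟩ := h
    refine Finset.sum_lt_sum (fun k _ => hle k) ⟨i, Finset.mem_univ _, ?_⟩
    have hj : (⟨i, hij ▸ j.2⟩ : Fin r) = j := Fin.ext hij
    rw [← Fin.lt_def]
    simp only [hmin i (hij ▸ j.2), hj]
    exact min_lt_of_right_lt hlt
  · rintro i j rfl hij hlt
    obtain rfl : i = j := Fin.ext hij
    refine Finset.sum_lt_sum (fun k _ => ?_) ⟨i, Finset.mem_univ _, ?_⟩
    · rw [← Fin.le_def]
      simp only [hmin k k.2]
      exact min_le_right _ _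
    · rw [← Fin.lt_def]
      simp only [hmin i i.2]
      exact min_lt_of_left_lt hlt

/-- If `b_j > a_{j+1}` and some `b_l` with `l ≥ j` is not in `L(a)`, then a segment of `b` can be
exchanged with a segment of `a` further to the right. Its ends are chosen as follows. On the right,
`b_l` falls into a gap between consecutive intervals of `a`, so both rows can be continued there
with their own entries. On the left, the segments start at the first column in which the entry of
the shifted row `a` is smaller than that of `b`. The exchange moves the first entry `x` of the
segment of `a` to an earlier position. -/
theorem exists_segmentSwap (a : CChain c n s) (b : CChain c n r)
    (i₀ : Fin s) (j₀ : Fin r) (hi₀ : (i₀ : ℕ) = j₀ + 1) (hlt : a.1 i₀ < b.1 j₀)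
    (l : Fin r) (hl : j₀ ≤ l) (hbl : (b.1 l : ℕ) ∉ intervalUnion a) :
    ∃ (a' : CChain c n s) (b' : CChain c n r) (x : Fin n),
      chainExponent a' + chainExponent b' = chainExponent a + chainExponent b ∧
      (∀ y < x, position a' y + position b' y = position a y + position b y) ∧
      position a' x + position b' x < position a x + position b x := by
  classical
  -- an entry of `b` outside of `L(a)` that is larger than the entry of `a` in the next column
  obtain ⟨l, j₁, hj₁, hj₁l, hbl⟩ : ∃ (l : Fin r) (j : Fin s), (l : ℕ) + 1 ≤ j ∧
      a.1 j < b.1 l ∧ (b.1 l : ℕ) ∉ intervalUnion a := by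
    by_contra! hcon
    have key : ∀ m : ℕ, ∀ hm : j₀ + m < r,
        ∃ j : Fin s, (j₀ : ℕ) + m + 1 ≤ j ∧ a.1 j < b.1 ⟨j₀ + m, hm⟩ := by
      intro m
      induction m with
      | zero => exact fun hm => ⟨i₀, by omega, by simpa using hlt⟩
      | succ m ih =>
        intro hm
        obtain ⟨j, hj, hjl⟩ := ih (by omega)
        obtain ⟨q, -, hq1, hq2⟩ := hcon ⟨j₀ + m, by omega⟩ j hj hjl
        have hjq : j < q := a.strictMono.lt_iff_lt.1 (lt_of_lt_of_le hjl hq2)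
        have := b.2 ⟨j₀ + m, by omega⟩ ⟨j₀ + (m + 1), hm⟩ (by simp [Fin.lt_def])
        refine ⟨q, ?_, ?_⟩
        · rw [Fin.lt_def] at hjq
          omega
        · rw [Fin.lt_def]
          omega
    obtain ⟨j, hj, hjl⟩ := key (l - j₀) (by rw [Fin.le_def] at hl; omega)
    have he : (⟨j₀ + (l - j₀), by rw [Fin.le_def] at hl; omega⟩ : Fin r) = l := by
      rw [Fin.le_def] at hl
      ext
      simp only
      omega
    rw [he] at hjl
    exact hbl (hcon l j (by rw [Fin.le_def] at hl; omega) hjl)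
  -- the last entry of `a` below `b_l`
  obtain ⟨j, hjl, hjmax⟩ : ∃ j : Fin s, a.1 j < b.1 l ∧ ∀ k, a.1 k < b.1 l → k ≤ j := by
    have hne : (Finset.univ.filter fun k => a.1 k < b.1 l).Nonempty := ⟨j₁, by simpa using hj₁l⟩
    exact ⟨Finset.max' _ hne, (Finset.mem_filter.1 (Finset.max'_mem _ hne)).2,
      fun k hk => Finset.le_max' _ k (by simpa using hk)⟩
  have hlj : (l : ℕ) + 1 ≤ j := hj₁.trans (hjmax _ hj₁l)
  have hend : ∀ k, j < k → (b.1 l : ℕ) + c < a.1 k := by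
    intro k hk
    by_contra! hc
    refine hbl ⟨k, by rw [Fin.lt_def] at hk; omega, hc, ?_⟩
    have : ¬ a.1 k < b.1 l := fun h => absurd (hjmax k h) (not_le.2 hk)
    exact_mod_cast not_lt.1 this
  obtain ⟨δ, hδ⟩ : ∃ δ, (j : ℕ) = l + δ := ⟨j - l, by omega⟩
  -- the first column at which `a`, shifted by `δ`, is below `b`
  obtain ⟨i, hil, hir, his, hib, hmin⟩ : ∃ i : ℕ, i ≤ l ∧ ∃ (hr : i < r) (hs : i + δ < s),
      a.1 ⟨i + δ, hs⟩ < b.1 ⟨i, hr⟩ ∧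
      ∀ (m : ℕ) (hr : m < r) (hs : m + δ < s), m < i → b.1 ⟨m, hr⟩ ≤ a.1 ⟨m + δ, hs⟩ := by
    let P : ℕ → Prop := fun m => ∃ (hr : m < r) (hs : m + δ < s), a.1 ⟨m + δ, hs⟩ < b.1 ⟨m, hr⟩
    have hP : P l := by
      refine ⟨l.2, hδ ▸ j.2, ?_⟩
      have he : (⟨l + δ, hδ ▸ j.2⟩ : Fin s) = j := Fin.ext hδ.symm
      rw [he]
      exact hjl
    have hex : ∃ m, P m := ⟨l, hP⟩
    obtain ⟨hr, hs, hlt⟩ := Nat.find_spec hex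
    refine ⟨Nat.find hex, Nat.find_min' hex hP, hr, hs, hlt, fun m hmr hms hm => ?_⟩
    exact not_lt.1 fun hc => Nat.find_min hex hm ⟨hmr, hms, hc⟩
  set x : Fin n := a.1 ⟨i + δ, his⟩ with hx
  have hax : ∀ k : Fin s, (k : ℕ) < i + δ → (a.1 k : ℕ) + c < x := fun k hk =>
    a.2 k ⟨i + δ, his⟩ hk
  have hbx : ∀ k : Fin r, (k : ℕ) < i → (b.1 k : ℕ) + c < x := by
    intro k hk
    have h1 := hmin k k.2 (by omega) hk
    have h2 := a.2 ⟨k + δ, by omega⟩ ⟨i + δ, his⟩ (by rw [Fin.lt_def]; simp only; omega)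
    rw [Fin.le_def] at h1
    simp only [Fin.eta] at h1
    omega
  have hxa : ∀ k : Fin s, i + δ ≤ k → (x : ℕ) ≤ a.1 k := fun k hk =>
    a.strictMono.monotone (Fin.le_def.2 hk)
  have hxb : ∀ k : Fin r, i ≤ k → (x : ℕ) < b.1 k := fun k hk =>
    lt_of_lt_of_le (Fin.lt_def.1 hib) (b.strictMono.monotone (Fin.le_def.2 hk))
  have haj : ∀ k : Fin s, (k : ℕ) ≤ l + δ → (a.1 k : ℕ) ≤ a.1 j := fun k hk =>
    a.strictMono.monotone (Fin.le_def.2 (by omega))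
  have hbl' : ∀ k : Fin r, (k : ℕ) ≤ l → (b.1 k : ℕ) ≤ b.1 l := fun k hk =>
    b.strictMono.monotone (Fin.le_def.2 hk)
  have haend : ∀ k : Fin s, (l : ℕ) + δ < k → (b.1 l : ℕ) + c < a.1 k := fun k hk =>
    hend k (Fin.lt_def.2 (by omega))
  have hbend : ∀ k : Fin r, (l : ℕ) < k → (a.1 j : ℕ) + c < b.1 k := by
    intro k hk
    have := b.2 l k hk
    rw [Fin.lt_def] at hjl
    omega
  have hs' : ∀ m, i ≤ m ∧ m ≤ l → m + δ < s := fun m hm => by have := j.2; omega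
  have hr' : ∀ m, i ≤ m ∧ m ≤ l → m < r := fun m hm => lt_of_le_of_lt hm.2 l.2
  let π := shiftSwap s r δ (fun m => i ≤ m ∧ m ≤ l) hs' hr'
  let v : Fin s ⊕ Fin r → Fin n := Sum.elim a.1 b.1
  have ha' : ∀ k₁ k₂ : Fin s, k₁ < k₂ →
      (v (π (.inl k₁)) : ℕ) + c < v (π (.inl k₂)) := by
    intro k₁ k₂ hk
    have h0 := a.2 k₁ k₂ hk
    rw [Fin.lt_def] at hk
    simp only [π, shiftSwap]
    split_ifs with h1 h2 h2
    · exact b.2 _ _ (by rw [Fin.lt_def]; simp only; omega)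
    · have h3 := hbl' ⟨k₁ - δ, hr' _ h1.2⟩ h1.2.2
      have h4 := haend k₂ (by omega)
      simp only [v, Sum.elim_inr, Sum.elim_inl]
      omega
    · have h3 := hax k₁ (by omega)
      have h4 := hxb ⟨k₂ - δ, hr' _ h2.2⟩ h2.2.1
      simp only [v, Sum.elim_inr, Sum.elim_inl]
      omega
    · exact h0
  have hb' : ∀ k₁ k₂ : Fin r, k₁ < k₂ →
      (v (π (.inr k₁)) : ℕ) + c < v (π (.inr k₂)) := by
    intro k₁ k₂ hk
    have h0 := b.2 k₁ k₂ hk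
    rw [Fin.lt_def] at hk
    simp only [π, shiftSwap]
    split_ifs with h1 h2 h2
    · exact a.2 _ _ (by rw [Fin.lt_def]; simp only; omega)
    · have h3 := haj ⟨k₁ + δ, hs' _ h1⟩ (by simp only; omega)
      have h4 := hbend k₂ (by omega)
      simp only [v, Sum.elim_inr, Sum.elim_inl]
      omega
    · have h3 := hbx k₁ (by omega)
      have h4 := hxa ⟨k₂ + δ, hs' _ h2⟩ (by simp only; omega)
      simp only [v, Sum.elim_inr, Sum.elim_inl]
      omega
    · exact h0
  have hπa : ∀ k : Fin s, (k : ℕ) < i + δ → v (π (.inl k)) = a.1 k := by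
    intro k hk
    simp only [π, shiftSwap]
    rw [dif_neg (by omega)]
    rfl
  have hπxa : ∀ k : Fin s, i + δ ≤ k → (x : ℕ) < v (π (.inl k)) := by
    intro k hk
    simp only [π, shiftSwap]
    split_ifs with h1
    · exact hxb _ h1.2.1
    · exact lt_of_lt_of_le (Fin.lt_def.1 hib)
        ((hbl' ⟨i, hir⟩ hil).trans (by
          have := haend k (by omega)
          simp only [v, Sum.elim_inl]
          omega))
  have hπb : ∀ k : Fin r, (k : ℕ) < i → v (π (.inr k)) = b.1 k := by
    intro k hk
    simp only [π, shiftSwap]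
    rw [dif_neg (by omega)]
    rfl
  have hπi : v (π (.inr ⟨i, hir⟩)) = x := by
    simp only [π, shiftSwap]
    rw [dif_pos ⟨le_rfl, hil⟩]
    rfl
  have hπxb : ∀ k : Fin r, i < k → (x : ℕ) < v (π (.inr k)) := by
    intro k hk
    have := hb' ⟨i, hir⟩ k hk
    rw [hπi] at this
    omega
  refine ⟨⟨fun k => v (π (.inl k)), ha'⟩, ⟨fun k => v (π (.inr k)), hb'⟩, x, ?_, ?_, ?_⟩
  · exact sum_shiftSwap δ _ hs' hr' fun z => Finsupp.single (v z) 1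
  · intro y hy
    rw [Fin.lt_def] at hy
    congr 1
    · refine Finset.sum_congr rfl fun k _ => ?_
      rcases lt_or_ge (k : ℕ) (i + δ) with hk | hk
      · simp only [hπa k hk]
      · have h1 := hπxa k hk
        have h2 := hxa k hk
        simp only
        rw [if_neg (fun h => by omega), if_neg (fun h => by omega)]
    · refine Finset.sum_congr rfl fun k _ => ?_
      rcases lt_trichotomy (k : ℕ) i with hk | hk | hk
      · simp only [hπb k hk]
      · have h1 : k = ⟨i, hir⟩ := Fin.ext hk
        have h2 := hxb k hk.ge
        simp only
        rw [if_neg (fun h => by rw [h1, hπi] at h; omega), if_neg (fun h => by omega)]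
      · have h1 := hπxb k hk
        have h2 := hxb k hk.le
        simp only
        rw [if_neg (fun h => by omega), if_neg (fun h => by omega)]
  · have h1 : ∑ k, (if v (π (.inl k)) = x then (k : ℕ) else 0) = 0 := by
      refine Finset.sum_eq_zero fun k _ => if_neg fun h => ?_
      rcases lt_or_ge (k : ℕ) (i + δ) with hk | hk
      · rw [hπa k hk] at h
        have := hax k hk
        omega
      · have := hπxa k hk
        omega
    have h2 : ∑ k, (if v (π (.inr k)) = x then (k : ℕ) else 0) = i := by
      rw [Finset.sum_eq_single ⟨i, hir⟩, if_pos hπi]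
      · intro k _ hk
        refine if_neg fun h => hk ?_
        have hinj : Function.Injective fun k : Fin r => v (π (.inr k)) :=
          CChain.strictMono ⟨_, hb'⟩ |>.injective
        exact hinj (h.trans hπi.symm)
      · simp
    have h3 : i + δ ≤ position a x :=
      le_of_eq_of_le (by simp [hx]) (Finset.single_le_sum
        (f := fun k : Fin s => if a.1 k = x then (k : ℕ) else 0) (fun _ _ => Nat.zero_le _)
        (Finset.mem_univ ⟨i + δ, his⟩))
    change (∑ k, if v (π (.inl k)) = x then (k : ℕ) else 0) +
      (∑ k, if v (π (.inr k)) = x then (k : ℕ) else 0) < _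
    rw [h1, h2]
    omega

end Exchange

/-! ### Weight orders -/

section WeightOrder

variable {σ τ : Type*}

/-- The pullback of a monomial order along an injective additive map of the exponent vectors. -/
noncomputable def pullbackOrder (m : MonomialOrder τ) (φ : (σ →₀ ℕ) →+ (τ →₀ ℕ))
    (hφ : Function.Injective φ) : MonomialOrder σ where
  syn := AddMonoidHom.mrange (m.toSyn.toAddMonoidHom.comp φ)
  addCommMonoidSyn := inferInstance
  linearOrderSyn := inferInstance
  isOrderedAddMonoid_syn := inferInstance
  toSyn := AddEquiv.ofBijective (m.toSyn.toAddMonoidHom.comp φ).mrangeRestrict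
    ⟨fun u v huv => hφ (m.toSyn.injective (Subtype.ext_iff.1 huv)),
      AddMonoidHom.mrangeRestrict_surjective _⟩
  toSyn_monotone := fun u v huv => by
    obtain ⟨w, rfl⟩ := exists_add_of_le huv
    change m.toSyn (φ u) ≤ m.toSyn (φ (u + w))
    rw [map_add, map_add]
    exact m.le_add_right _ _

theorem pullbackOrder_lt_iff (m : MonomialOrder τ) (φ : (σ →₀ ℕ) →+ (τ →₀ ℕ))
    (hφ : Function.Injective φ) (u v : σ →₀ ℕ) :
    (pullbackOrder m φ hφ).toSyn u < (pullbackOrder m φ hφ).toSyn v ↔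
      m.toSyn (φ u) < m.toSyn (φ v) := Iff.rfl

variable [Fintype σ] {ι : Type*} [Finite ι]

instance finite_sumLex {α β : Type*} [Finite α] [Finite β] : Finite (α ⊕ₗ β) :=
  inferInstanceAs (Finite (α ⊕ β))

/-- The vector of the weights of a variable, followed by the coordinates of its exponent vector
with respect to some enumeration of the variables. -/
noncomputable def weightVector (w : ι → σ → ℕ) (y : σ) :
    (ι ⊕ₗ Fin (Fintype.card σ)) →₀ ℕ :=
  Finsupp.equivFunOnFinite.symm fun x =>
    Sum.elim (fun i => w i y) (fun j => if j = Fintype.equivFin σ y then 1 else 0) (ofLex x)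

theorem weightVector_injective (w : ι → σ → ℕ) :
    Function.Injective (Finsupp.linearCombination ℕ (weightVector w)).toAddMonoidHom := by
  classical
  have key : ∀ (u : σ →₀ ℕ) (y : σ), (Finsupp.linearCombination ℕ (weightVector w) u)
      (toLex (Sum.inr (Fintype.equivFin σ y))) = u y := by
    intro u y
    rw [Finsupp.linearCombination_apply, Finsupp.sum, Finsupp.finsetSum_apply]
    simp only [weightVector, Finsupp.smul_apply, Finsupp.equivFunOnFinite_symm_apply_apply,
      ofLex_toLex, Sum.elim_inr, EmbeddingLike.apply_eq_iff_eq, smul_eq_mul, mul_ite, mul_one,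
      mul_zero]
    simpa using Eq.symm
  intro u v huv
  ext y
  rw [← key u y, ← key v y]
  exact DFunLike.congr_fun huv _

variable [LinearOrder ι]

/-- The monomial order that compares the weights `w i` one after the other, ties being broken
lexicographically. -/
noncomputable def weightOrder (w : ι → σ → ℕ) : MonomialOrder σ :=
  pullbackOrder MonomialOrder.lex _ (weightVector_injective w)

theorem weightOrder_lt (w : ι → σ → ℕ) {y z y' z' : σ} (i : ι)
    (heq : ∀ j < i, w j y' + w j z' = w j y + w j z) (hlt : w i y' + w i z' < w i y + w i z) :
    (weightOrder w).toSyn (Finsupp.single y' 1 + Finsupp.single z' 1) <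
      (weightOrder w).toSyn (Finsupp.single y 1 + Finsupp.single z 1) := by
  rw [weightOrder, pullbackOrder_lt_iff, MonomialOrder.lex_lt_iff, Finsupp.Lex.lt_iff]
  refine ⟨toLex (Sum.inl i), fun j hj => ?_, ?_⟩
  · rcases hj' : ofLex j with j' | j'
    · obtain rfl : j = toLex (Sum.inl j') := by rw [← hj', toLex_ofLex]
      have := heq j' (Sum.Lex.inl_lt_inl_iff.1 hj)
      simpa [weightVector] using this
    · obtain rfl : j = toLex (Sum.inr j') := by rw [← hj', toLex_ofLex]
      exact absurd hj Sum.Lex.not_inr_lt_inl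
  · simpa [weightVector] using hlt

end WeightOrder

/-! ### The order on tables -/

section TableOrder

variable {c n k : ℕ} {t : Fin k → ℕ}

/-- The relation between two factors of a monomial that the definition of quasi-sorted monomials
imposes on each pair of rows, the first row being listed before the second one. -/
def QuasiSortedRel (y z : YVar c n t) : Prop :=
  QuasiSortedPair y.2 z.2 ∧ (t y.1 = t z.1 → y.1 ≤ z.1)

theorem QuasiSortedRel.refl (y : YVar c n t) : QuasiSortedRel y y :=
  ⟨QuasiSortedPair.refl _, fun _ => le_rfl⟩

variable (t) in
/-- The rank of a label: labels of longer rows come first, and labels of rows of the same length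
come in their natural order. -/
def labelRank (i : Fin k) : ℕ := (∑ j, t j - t i) * k + i

theorem labelRank_lt_of_length_lt {i j : Fin k} (h : t j < t i) :
    labelRank t i < labelRank t j := by
  have hi : t i ≤ ∑ j, t j := Finset.single_le_sum (fun _ _ => Nat.zero_le _) (Finset.mem_univ i)
  have h1 : (∑ j, t j - t i + 1) * k ≤ (∑ j, t j - t j) * k := Nat.mul_le_mul_right k (by omega)
  have h2 := i.2
  rw [labelRank, labelRank]
  rw [Nat.add_mul] at h1
  omega

theorem labelRank_lt_of_lt {i j : Fin k} (ht : t j = t i) (h : i < j) :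
    labelRank t i < labelRank t j := by
  rw [labelRank, labelRank, ht]
  exact Nat.add_lt_add_left h _

/-- The sum of the entries of a row, shifted according to the label. The factor of the rank exceeds
all sums of entries, so that rows whose labels have different ranks are compared by the ranks. -/
def spread (y : YVar c n t) : ℕ :=
  entrySum y.2 + (∑ z : YVar c n t, entrySum z.2 + 1) * labelRank t y.1

theorem spread_lt_of_rank_lt {y z : YVar c n t} (h : labelRank t y.1 < labelRank t z.1) :
    spread y < spread z := by
  have hy : entrySum y.2 ≤ ∑ z : YVar c n t, entrySum z.2 :=
    Finset.single_le_sum (f := fun z : YVar c n t => entrySum z.2) (fun _ _ => Nat.zero_le _)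
      (Finset.mem_univ y)
  have := Nat.mul_le_mul_left (∑ z : YVar c n t, entrySum z.2 + 1) (Nat.succ_le_of_lt h)
  rw [spread, spread]
  rw [Nat.mul_succ] at this
  omega

/-- A strictly concave function of `spread`. The constant is an upper bound for the square, so the
subtraction is not truncated. -/
def concaveWeight (y : YVar c n t) : ℕ := (∑ z : YVar c n t, spread z) ^ 2 - spread y ^ 2

theorem concaveWeight_lt {y z y' z' : YVar c n t} (h : spread y' + spread z' = spread y + spread z)
    (h1 : spread y' < spread y) (h2 : spread y' < spread z) :
    concaveWeight y' + concaveWeight z' < concaveWeight y + concaveWeight z := by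
  have hC : ∀ y : YVar c n t, spread y ^ 2 ≤ (∑ z : YVar c n t, spread z) ^ 2 := fun y =>
    Nat.pow_le_pow_left (Finset.single_le_sum (f := fun z : YVar c n t => spread z)
      (fun _ _ => Nat.zero_le _) (Finset.mem_univ y)) 2
  have a1 := hC y
  have a2 := hC z
  have a3 := hC y'
  have a4 := hC z'
  have key : spread y ^ 2 + spread z ^ 2 < spread y' ^ 2 + spread z' ^ 2 := by
    obtain ⟨p, hp⟩ := exists_add_of_le h1.le
    obtain ⟨q, hq⟩ := exists_add_of_le h2.le
    have hz' : spread z' = spread y' + p + q := by omega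
    have hp0 : 0 < p := by omega
    have hq0 : 0 < q := by omega
    rw [hz', hp, hq]
    nlinarith [Nat.mul_pos hp0 hq0]
  simp only [concaveWeight]
  omega

/-- The weights that single out quasi-sorted tables: the positions at which the entries
`1, 2, …` occur, in turn, and the concave weight. -/
def tableWeight : WithTop (Fin n) → YVar c n t → ℕ
  | (x : Fin n), y => position y.2 x
  | ⊤, y => concaveWeight y

variable (c n t) in
/-- The monomial order for which the quasi-sorted monomials are the standard ones. -/
noncomputable def tableOrder : MonomialOrder (YVar c n t) := weightOrder tableWeight

/-- The product of the variables `y` and `z` is not the smallest monomial of its fiber: there are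
two rows with the same labels and, together, the same entries whose product is smaller. -/
def ReduciblePair (y z : YVar c n t) : Prop :=
  ∃ y' z' : YVar c n t, y'.1 = y.1 ∧ z'.1 = z.1 ∧
      chainExponent y'.2 + chainExponent z'.2 = chainExponent y.2 + chainExponent z.2 ∧
      (tableOrder c n t).toSyn (Finsupp.single y' 1 + Finsupp.single z' 1) <
        (tableOrder c n t).toSyn (Finsupp.single y 1 + Finsupp.single z 1)

theorem ReduciblePair.symm {y z : YVar c n t} (h : ReduciblePair y z) : ReduciblePair z y := by
  obtain ⟨y', z', h1, h2, h3, h4⟩ := h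
  exact ⟨z', y', h2, h1, by rw [add_comm, h3, add_comm],
    by rwa [add_comm (Finsupp.single z' 1), add_comm (Finsupp.single z 1)]⟩

/-- If the columns weakly increase, a segment of the first row is exchanged with a segment of the
second one; this moves the first entry `x` involved to an earlier position. -/
theorem reduciblePair_of_columns_le {y z : YVar c n t} (hlen : t z.1 ≤ t y.1)
    (hlab : t y.1 = t z.1 → y.1 ≤ z.1)
    (hcol : ∀ (p : Fin (t y.1)) (q : Fin (t z.1)), (p : ℕ) = q → y.2.1 p ≤ z.2.1 q)
    (h : ¬ QuasiSortedRel y z) : ReduciblePair y z := by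
  have hL : ¬ ∀ (i : Fin (t y.1)) (j : Fin (t z.1)), (i : ℕ) = (j : ℕ) + 1 → y.2.1 i < z.2.1 j →
      ∀ l : Fin (t z.1), j ≤ l → (z.2.1 l : ℕ) ∈ intervalUnion y.2 := fun hL =>
    h ⟨⟨chainGE_of_le hlen hcol, hcol, hL⟩, hlab⟩
  push Not at hL
  obtain ⟨i, j, hij, hlt, l, hl, hzl⟩ := hL
  obtain ⟨a', b', x, he, hpos, hx⟩ := exists_segmentSwap y.2 z.2 i j hij hlt l hl hzl
  refine ⟨⟨y.1, a'⟩, ⟨z.1, b'⟩, rfl, rfl, he,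
    weightOrder_lt tableWeight (x : WithTop (Fin n)) ?_ hx⟩
  intro w hw
  obtain ⟨w, rfl⟩ := WithTop.ne_top_iff_exists.1 hw.ne_top
  exact hpos w (WithTop.coe_lt_coe.1 hw)

/-- Sorting the columns keeps the positions of all entries. It lowers `spread` for the first row,
which ends up below both previous values, and raises it for the second row by the same amount, so
that the sum of the concave weights drops. -/
theorem reduciblePair_of_not_columns_le {y z : YVar c n t} (hlen : t z.1 ≤ t y.1)
    (hcol : ∃ (p : Fin (t y.1)) (q : Fin (t z.1)), (p : ℕ) = q ∧ z.2.1 q < y.2.1 p)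
    (h : labelRank t y.1 < labelRank t z.1 ∨ y.1 = z.1 ∧
      ∃ (p : Fin (t y.1)) (q : Fin (t z.1)), (p : ℕ) = q ∧ y.2.1 p < z.2.1 q) :
    ReduciblePair y z := by
  obtain ⟨a', b', he, hpos, hsum, hlt, hlt'⟩ := exists_columnSort hlen y.2 z.2 hcol
  refine ⟨⟨y.1, a'⟩, ⟨z.1, b'⟩, rfl, rfl, he, weightOrder_lt tableWeight ⊤ ?_ ?_⟩
  · intro w hw
    obtain ⟨w, rfl⟩ := WithTop.ne_top_iff_exists.1 hw.ne_top
    exact hpos w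
  · have h1 : spread (⟨y.1, a'⟩ : YVar c n t) < spread y := Nat.add_lt_add_right hlt _
    refine concaveWeight_lt ?_ h1 ?_
    · simp only [spread]
      omega
    · rcases h with h | ⟨hyz, p, q, hpq, hlt⟩
      · exact h1.trans (spread_lt_of_rank_lt h)
      · have := hlt' p q (by rw [hyz]) hpq hlt
        simp only [spread, ← hyz]
        omega

theorem reduciblePair_of_not_quasiSortedRel {y z : YVar c n t} (h : ¬ QuasiSortedRel y z)
    (h' : ¬ QuasiSortedRel z y) :
    ReduciblePair y z := by
  -- the case in which the label of the first row comes before that of the second one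
  have key : ∀ {y z : YVar c n t}, ¬ QuasiSortedRel y z → t z.1 ≤ t y.1 →
      (t y.1 = t z.1 → y.1 ≤ z.1) → labelRank t y.1 < labelRank t z.1 → ReduciblePair y z := by
    intro y z h hlen hlab hrank
    by_cases hcol : ∀ (p : Fin (t y.1)) (q : Fin (t z.1)), (p : ℕ) = q → y.2.1 p ≤ z.2.1 q
    · exact reduciblePair_of_columns_le hlen hlab hcol h
    · push Not at hcol
      exact reduciblePair_of_not_columns_le hlen hcol (Or.inl hrank)
  rcases lt_trichotomy (t y.1) (t z.1) with hlt | heq | hgt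
  · exact ReduciblePair.symm
      (key h' hlt.le (fun h => absurd h hlt.ne') (labelRank_lt_of_length_lt hlt))
  · rcases lt_trichotomy y.1 z.1 with hl | hl | hl
    · exact key h heq.ge (fun _ => hl.le) (labelRank_lt_of_lt heq.symm hl)
    · by_cases hcol : ∀ (p : Fin (t y.1)) (q : Fin (t z.1)), (p : ℕ) = q → y.2.1 p ≤ z.2.1 q
      · exact reduciblePair_of_columns_le heq.ge (fun _ => hl.le) hcol h
      by_cases hcol' : ∀ (p : Fin (t z.1)) (q : Fin (t y.1)), (p : ℕ) = q → z.2.1 p ≤ y.2.1 q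
      · exact ReduciblePair.symm (reduciblePair_of_columns_le heq.le (fun _ => hl.ge) hcol' h')
      · push Not at hcol hcol'
        obtain ⟨p, q, hpq, hlt⟩ := hcol'
        exact reduciblePair_of_not_columns_le heq.ge hcol (Or.inr ⟨hl, q, p, hpq.symm, hlt⟩)
    · exact ReduciblePair.symm (key h' heq.le (fun _ => hl.le) (labelRank_lt_of_lt heq hl))
  · exact key h hgt.le (fun h => absurd h hgt.ne') (labelRank_lt_of_length_lt hgt)

end TableOrder

/-! ### Exponent vectors as sums of tuples -/

section Tuples

variable {α : Type*} {d : ℕ}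

theorem exists_perm_of_sum_single_eq {f g : Fin d → α}
    (h : ∑ e, Finsupp.single (f e) 1 = (∑ e, Finsupp.single (g e) 1 : α →₀ ℕ)) :
    ∃ σ : Equiv.Perm (Fin d), ∀ e, g (σ e) = f e := by
  classical
  have hcard : ∀ a, Fintype.card {e // f e = a} = Fintype.card {e // g e = a} := by
    intro a
    have := DFunLike.congr_fun h a
    rw [Finsupp.finsetSum_apply, Finsupp.finsetSum_apply] at this
    simp only [Finsupp.single_apply] at this
    rwa [Fintype.card_subtype, Fintype.card_subtype, Finset.card_filter, Finset.card_filter]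
  exact ⟨Equiv.ofFiberEquiv fun a => Fintype.equivOfCardEq (hcard a),
    fun e => Equiv.ofFiberEquiv_map _ e⟩

theorem exists_sum_single_eq (u : α →₀ ℕ) :
    ∃ (d : ℕ) (p : Fin d → α), u = ∑ e, Finsupp.single (p e) 1 := by
  induction u using Finsupp.induction_linear with
  | zero => exact ⟨0, Fin.elim0, by simp⟩
  | add u v hu hv =>
    obtain ⟨d, p, rfl⟩ := hu
    obtain ⟨d', p', rfl⟩ := hv
    exact ⟨d + d', Fin.append p p', by simp [Fin.sum_univ_add]⟩
  | single a m => exact ⟨m, fun _ => a, by simp⟩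

/-- Every exponent vector is the sum of a tuple that is sorted with respect to a given key. -/
theorem exists_monotone_sum_single_eq {β : Type*} [LinearOrder β] (key : α → β) (u : α →₀ ℕ) :
    ∃ (d : ℕ) (p : Fin d → α), u = ∑ e, Finsupp.single (p e) 1 ∧ Monotone fun e => key (p e) := by
  obtain ⟨d, p, rfl⟩ := exists_sum_single_eq u
  refine ⟨d, p ∘ Tuple.sort (key ∘ p), ?_, Tuple.monotone_sort (key ∘ p)⟩
  exact (Equiv.sum_comp (Tuple.sort (key ∘ p)) fun e => Finsupp.single (p e) 1).symm

theorem single_add_single_le_sum {p : Fin d → α} {e f : Fin d} (hef : e ≠ f) :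
    Finsupp.single (p e) 1 + Finsupp.single (p f) 1 ≤
      (∑ e, Finsupp.single (p e) 1 : α →₀ ℕ) := by
  rw [← Finset.sum_pair (f := fun e => Finsupp.single (p e) 1) hef]
  exact Finset.sum_le_sum_of_subset (Finset.subset_univ _)

theorem exists_eq_of_single_le_sum {p : Fin d → α} {y : α}
    (h : Finsupp.single y 1 ≤ (∑ e, Finsupp.single (p e) 1 : α →₀ ℕ)) : ∃ e, p e = y := by
  classical
  by_contra! hne
  have h1 := h y
  rw [Finsupp.finsetSum_apply, Finset.sum_eq_zero fun e _ => Finsupp.single_eq_of_ne (hne e).symm]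
    at h1
  simp at h1

end Tuples

/-! ### Quasi-sorted monomials -/

section Monomials

variable {c n k : ℕ} {t : Fin k → ℕ}

/-- The multidegree of a monomial in the `Y`-variables: the exponent vectors of its image in
`K[x_1, …, x_n][T_1, …, T_k]` with respect to the `T_i` and the `x_j`. -/
noncomputable def multidegree : (YVar c n t →₀ ℕ) →+ (Fin k →₀ ℕ) × (Fin n →₀ ℕ) :=
  (Finsupp.linearCombination ℕ fun y : YVar c n t =>
    (Finsupp.single y.1 1, chainExponent y.2)).toAddMonoidHom

theorem multidegree_single (y : YVar c n t) :
    multidegree (Finsupp.single y 1) = (Finsupp.single y.1 1, chainExponent y.2) := by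
  simp [multidegree]

theorem multidegree_sum_single {d : ℕ} (p : Fin d → YVar c n t) :
    multidegree (∑ e, Finsupp.single (p e) 1) =
      (∑ e, Finsupp.single (p e).1 1, ∑ e, chainExponent (p e).2) := by
  rw [map_sum]
  simp only [multidegree_single]
  exact Prod.ext (Prod.fst_sum ..) (Prod.snd_sum ..)

theorem length_eq_of_multidegree_eq {d d' : ℕ} {p : Fin d → YVar c n t}
    {q : Fin d' → YVar c n t} (h : multidegree (∑ e, Finsupp.single (p e) 1) =
      multidegree (∑ e, Finsupp.single (q e) 1)) : d = d' := by
  rw [multidegree_sum_single, multidegree_sum_single] at h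
  have := congrArg (fun x => Finsupp.degree x.1) h
  simpa using this

/-- Two quasi-sorted monomials of the same multidegree are equal. -/
theorem QuasiSortedMonomial.eq_of_multidegree_eq {u v : YVar c n t →₀ ℕ}
    (hu : QuasiSortedMonomial u) (hv : QuasiSortedMonomial v)
    (h : multidegree u = multidegree v) : u = v := by
  obtain ⟨d, p, rfl, hp⟩ := hu
  obtain ⟨d', q, rfl, hq⟩ := hv
  obtain rfl := length_eq_of_multidegree_eq h
  rw [multidegree_sum_single, multidegree_sum_single] at h
  obtain ⟨h1, h2⟩ := Prod.ext_iff.1 h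
  -- both tables list their labels in the order of this key
  let key : Fin k → ℕᵒᵈ ×ₗ Fin k := fun i => toLex (OrderDual.toDual (t i), i)
  have hmono : ∀ p : Fin d → YVar c n t,
      (∀ e f : Fin d, e < f → QuasiSortedPair (p e).2 (p f).2 ∧
        (t (p e).1 = t (p f).1 → (p e).1 ≤ (p f).1)) → Monotone fun e => key (p e).1 := by
    intro p hp e f hef
    rcases hef.eq_or_lt with rfl | hlt
    · exact le_rfl
    · obtain ⟨hs, hl⟩ := hp e f hlt
      refine Prod.Lex.toLex_le_toLex.2 ?_
      rcases (length_le_of_chainGE hs.1).lt_or_eq with hlt | heq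
      · exact Or.inl hlt
      · exact Or.inr ⟨congrArg OrderDual.toDual heq.symm, hl heq.symm⟩
  obtain ⟨σ, hσ⟩ := exists_perm_of_sum_single_eq h1
  have hlab : ∀ e, (p e).1 = (q e).1 := by
    have hp' := hmono p hp
    have hq' := hmono q hq
    have := Tuple.unique_monotone (f := fun e => key (q e).1) (σ := σ) (τ := 1)
      (by simpa [Function.comp_def, hσ] using hp') (by simpa using hq')
    intro e
    have he := congrFun this e
    simp only [Function.comp_apply, hσ, Equiv.Perm.coe_one, id_eq, key] at he
    exact (Prod.ext_iff.1 (toLex_inj.1 he)).2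
  obtain ⟨l, A, rfl⟩ : ∃ (l : Fin d → Fin k) (A : ∀ e, CChain c n (t (l e))),
    p = fun e => ⟨l e, A e⟩ := ⟨fun e => (p e).1, fun e => (p e).2, rfl⟩
  obtain ⟨l', B, rfl⟩ : ∃ (l : Fin d → Fin k) (A : ∀ e, CChain c n (t (l e))),
    q = fun e => ⟨l e, A e⟩ := ⟨fun e => (q e).1, fun e => (q e).2, rfl⟩
  obtain rfl : l = l' := funext hlab
  rw [quasiSorted_unique A B (fun e f hef => (hp e f hef).1) (fun e f hef => (hq e f hef).1) h2]

/-- Listing the factors in the degree lexicographic order, and then in the order of their labels,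
shows that it suffices to check the pairs of factors of a monomial. -/
theorem quasiSortedMonomial_of_pairs {u : YVar c n t →₀ ℕ}
    (h : ∀ y z : YVar c n t, Finsupp.single y 1 + Finsupp.single z 1 ≤ u →
      QuasiSortedRel y z ∨ QuasiSortedRel z y) : QuasiSortedMonomial u := by
  let key : YVar c n t → (MonomialOrder.degLex (σ := Fin n)).synᵒᵈ ×ₗ Fin k := fun y =>
    toLex (OrderDual.toDual (MonomialOrder.degLex.toSyn (chainExponent y.2)), y.1)
  have hinj : Function.Injective key := by
    rintro ⟨i, a⟩ ⟨j, b⟩ hij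
    obtain ⟨h1, h2⟩ := Prod.ext_iff.1 (toLex_inj.1 hij)
    simp only at h2
    subst h2
    have := chainExponent_injective (MonomialOrder.degLex.toSyn.injective
      (OrderDual.toDual_inj.1 h1))
    simp only at this
    rw [this]
  have hkey : ∀ y z, QuasiSortedRel y z → key y ≤ key z := by
    rintro y z ⟨hs, hl⟩
    refine Prod.Lex.toLex_le_toLex.2 ?_
    rcases hs.1.lt_or_eq with hlt | heq
    · exact Or.inl hlt
    · refine Or.inr ⟨congrArg OrderDual.toDual heq.symm, hl ?_⟩
      have := congrArg Finsupp.degree (MonomialOrder.degLex.toSyn.injective heq)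
      rw [degree_chainExponent, degree_chainExponent] at this
      exact this.symm
  obtain ⟨d, p, rfl, hp⟩ := exists_monotone_sum_single_eq key u
  refine ⟨d, p, rfl, fun e f hef => ?_⟩
  rcases h (p e) (p f) (single_add_single_le_sum hef.ne) with h1 | h1
  · exact h1
  · have : p e = p f := hinj (le_antisymm (hp hef.le) (hkey _ _ h1))
    rw [this]
    exact QuasiSortedRel.refl _

theorem QuasiSortedMonomial.rel_or_rel {u : YVar c n t →₀ ℕ} (hu : QuasiSortedMonomial u)
    {y z : YVar c n t} (h : Finsupp.single y 1 + Finsupp.single z 1 ≤ u) :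
    QuasiSortedRel y z ∨ QuasiSortedRel z y := by
  obtain ⟨d, p, rfl, hp⟩ := hu
  obtain ⟨e, rfl⟩ := exists_eq_of_single_le_sum (le_trans le_self_add h)
  obtain ⟨f, rfl⟩ := exists_eq_of_single_le_sum (le_trans le_add_self h)
  rcases lt_trichotomy e f with hef | rfl | hef
  · exact Or.inl (hp e f hef)
  · exact Or.inl (QuasiSortedRel.refl _)
  · exact Or.inr (hp f e hef)

/-- A monomial with factors that do not form a quasi-sorted pair is not the smallest one of its
multidegree. -/
theorem exists_lt_of_not_rel {u : YVar c n t →₀ ℕ} {y z : YVar c n t}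
    (hu : Finsupp.single y 1 + Finsupp.single z 1 ≤ u) (h : ¬ QuasiSortedRel y z)
    (h' : ¬ QuasiSortedRel z y) :
    ∃ v, multidegree v = multidegree u ∧
      (tableOrder c n t).toSyn v < (tableOrder c n t).toSyn u := by
  obtain ⟨y', z', h1, h2, h3, hlt⟩ := reduciblePair_of_not_quasiSortedRel h h'
  obtain ⟨w, rfl⟩ := exists_add_of_le hu
  refine ⟨Finsupp.single y' 1 + Finsupp.single z' 1 + w, ?_, ?_⟩
  · simp only [map_add, multidegree_single, h1, h2, Prod.mk_add_mk, h3]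
  · rw [map_add _ _ w, map_add _ _ w]
    exact add_lt_add_left hlt _

/-- A quasi-sorted monomial is the smallest monomial of its multidegree. -/
theorem QuasiSortedMonomial.le_of_multidegree_eq {u v : YVar c n t →₀ ℕ}
    (hu : QuasiSortedMonomial u) (h : multidegree v = multidegree u) :
    (tableOrder c n t).toSyn u ≤ (tableOrder c n t).toSyn v := by
  obtain ⟨w, hw, hmin⟩ := WellFounded.has_min
    (InvImage.wf (tableOrder c n t).toSyn (wellFounded_lt (α := (tableOrder c n t).syn)))
    {w | multidegree w = multidegree u} ⟨u, rfl⟩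
  have hw' : QuasiSortedMonomial w := by
    refine quasiSortedMonomial_of_pairs fun y z hyz => ?_
    by_contra! hcon
    obtain ⟨v, hv, hlt⟩ := exists_lt_of_not_rel hyz hcon.1 hcon.2
    exact hmin v (hv.trans hw) hlt
  rw [← hw'.eq_of_multidegree_eq hu hw]
  exact not_lt.1 (hmin v h)

end Monomials

/-! ### The toric ideal -/

open MvPolynomial

section ToricIdeal

variable (K : Type*) [Field K] {c n k : ℕ} {t : Fin k → ℕ}

theorem chainMonomial_eq {s : ℕ} (a : CChain c n s) :
    chainMonomial K a = monomial (chainExponent a) 1 := by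
  rw [chainMonomial, chainExponent, monomial_sum_one]
  rfl

variable (c n t) in
/-- The homomorphism from `K[Y]` to `K[x_1, …, x_n][T_1, …, T_k]` with `Y_(i, a) ↦ x_a T_i`. -/
noncomputable def toricMap :
    MvPolynomial (YVar c n t) K →ₐ[K] MvPolynomial (Fin k) (MvPolynomial (Fin n) K) :=
  aeval fun y => monomial (Finsupp.single y.1 1) (chainMonomial K y.2)

theorem monomial_sum_single {σ : Type*} {d : ℕ} (p : Fin d → σ) :
    monomial (∑ e, Finsupp.single (p e) 1) (1 : K) = ∏ e, X (p e) := by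
  rw [monomial_sum_one]
  rfl

theorem toricMap_monomial (u : YVar c n t →₀ ℕ) (a : K) :
    toricMap K c n t (monomial u a) =
      monomial (multidegree u).1 (monomial (multidegree u).2 a) := by
  obtain ⟨d, p, rfl⟩ := exists_sum_single_eq u
  rw [← mul_one a, ← smul_eq_mul, ← smul_monomial, map_smul, ← smul_monomial, ← smul_monomial]
  congr 1
  rw [monomial_sum_single, map_prod, multidegree_sum_single]
  simp only [toricMap, aeval_X, chainMonomial_eq]
  rw [← monomial_sum_prod, ← monomial_sum_one]

theorem coeff_coeff_toricMap (f : MvPolynomial (YVar c n t) K) (α : Fin k →₀ ℕ) (β : Fin n →₀ ℕ) :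
    coeff β (coeff α (toricMap K c n t f)) =
      ∑ u ∈ f.support with multidegree u = (α, β), coeff u f := by
  conv_lhs => rw [f.as_sum, map_sum, coeff_sum, coeff_sum]
  rw [Finset.sum_filter]
  refine Finset.sum_congr rfl fun u _ => ?_
  rw [toricMap_monomial, coeff_monomial]
  by_cases h1 : (multidegree u).1 = α
  · rw [if_pos h1, coeff_monomial]
    simp only [Prod.ext_iff, h1, true_and]
  · rw [if_neg h1, if_neg fun h => h1 (congrArg Prod.fst h), coeff_zero]

theorem monomial_sub_monomial_mem_toricIdeal {u v : YVar c n t →₀ ℕ}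
    (h : multidegree u = multidegree v) :
    monomial u 1 - monomial v 1 ∈ toricIdeal K c n t := by
  obtain ⟨d, p, rfl⟩ := exists_sum_single_eq u
  obtain ⟨d', q, rfl⟩ := exists_sum_single_eq v
  obtain rfl := length_eq_of_multidegree_eq h
  rw [multidegree_sum_single, multidegree_sum_single] at h
  obtain ⟨h1, h2⟩ := Prod.ext_iff.1 h
  obtain ⟨σ, hσ⟩ := exists_perm_of_sum_single_eq h1
  refine Ideal.subset_span ⟨d, p, fun e => q (σ e), fun e => (hσ e).symm, ?_, ?_⟩
  · apply Multiset.toFinsupp.injective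
    rw [map_sum, map_sum]
    simp only [toFinsupp_entries]
    rw [Equiv.sum_comp σ fun e => chainExponent (q e).2]
    exact h2
  · rw [monomial_sum_single, monomial_sum_single, Equiv.prod_comp σ fun e => X (q e)]

theorem toricIdeal_le_ker : toricIdeal K c n t ≤ RingHom.ker (toricMap K c n t) := by
  refine Ideal.span_le.2 ?_
  rintro _ ⟨d, p, q, hlab, hent, rfl⟩
  rw [SetLike.mem_coe, RingHom.mem_ker, map_sub, sub_eq_zero, ← monomial_sum_single,
    ← monomial_sum_single, toricMap_monomial, toricMap_monomial]
  have : multidegree (∑ e, Finsupp.single (p e) 1) = multidegree (∑ e, Finsupp.single (q e) 1) := by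
    rw [multidegree_sum_single, multidegree_sum_single]
    refine Prod.ext (by simp only [hlab]) ?_
    have := congrArg Multiset.toFinsupp hent
    rw [map_sum, map_sum] at this
    simpa only [toFinsupp_entries] using this
  rw [this]

/-- The binomials generate the kernel: modulo the binomials, all monomials of a given multidegree
agree, and the coefficients of those of an element of the kernel add up to zero. -/
theorem toricIdeal_eq_ker : toricIdeal K c n t = RingHom.ker (toricMap K c n t) := by
  refine le_antisymm (toricIdeal_le_ker K) fun f hf => ?_
  rw [RingHom.mem_ker] at hf
  have hmk : ∀ u v : YVar c n t →₀ ℕ, multidegree u = multidegree v →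
      Ideal.Quotient.mkₐ K (toricIdeal K c n t) (monomial u 1) =
        Ideal.Quotient.mkₐ K (toricIdeal K c n t) (monomial v 1) := fun u v h =>
    Ideal.Quotient.eq.2 (monomial_sub_monomial_mem_toricIdeal K h)
  let g : (Fin k →₀ ℕ) × (Fin n →₀ ℕ) → MvPolynomial (YVar c n t) K ⧸ toricIdeal K c n t :=
    fun γ => Ideal.Quotient.mkₐ K _ (monomial (Function.invFun multidegree γ) 1)
  have hg : ∀ (u : YVar c n t →₀ ℕ) (a : K),
      Ideal.Quotient.mkₐ K (toricIdeal K c n t) (monomial u a) = a • g (multidegree u) := by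
    intro u a
    rw [← mul_one a, ← smul_eq_mul, ← smul_monomial, map_smul, smul_eq_mul, mul_one]
    congr 1
    exact hmk _ _ (Function.invFun_eq ⟨u, rfl⟩).symm
  classical
  have hzero : Ideal.Quotient.mkₐ K (toricIdeal K c n t) f = 0 := by
    rw [f.as_sum, map_sum, ← Finset.sum_fiberwise_of_maps_to
      (t := f.support.image multidegree) (g := multidegree)
      (fun u hu => Finset.mem_image_of_mem _ hu)]
    refine Finset.sum_eq_zero fun γ _ => ?_
    have h1 : ∀ u ∈ f.support.filter fun u => multidegree u = γ,
        Ideal.Quotient.mkₐ K (toricIdeal K c n t) (monomial u (coeff u f)) = coeff u f • g γ := by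
      intro u hu
      rw [hg, (Finset.mem_filter.1 hu).2]
    rw [Finset.sum_congr rfl h1, ← Finset.sum_smul]
    have h2 := coeff_coeff_toricMap K f γ.1 γ.2
    rw [hf, coeff_zero, coeff_zero] at h2
    rw [← h2, zero_smul]
  exact Ideal.Quotient.eq_zero_iff_mem.1 hzero

end ToricIdeal

/-! ### The special fiber -/

section SpecialFiber

theorem coeff_mem_of_mem_fiberIdeal {R : Type*} [CommRing R] {k : ℕ} {M : Ideal R}
    {I : Fin k → Ideal R} {g : multiRees I} (hg : g ∈ fiberIdeal M I) (α : Fin k →₀ ℕ) :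
    coeff α g.1 ∈ M * ∏ i, I i ^ α i := by
  let Q : Ideal (multiRees I) :=
    { carrier := {g | ∀ α, coeff α g.1 ∈ M * ∏ i, I i ^ α i}
      add_mem' := by
        intro x y hx hy α
        change coeff α (x.1 + y.1) ∈ _
        rw [coeff_add]
        exact Ideal.add_mem _ (hx α) (hy α)
      zero_mem' := fun α => Ideal.zero_mem _
      smul_mem' := by
        intro a x hx α
        change coeff α (a.1 * x.1) ∈ _
        rw [coeff_mul]
        refine Ideal.sum_mem _ fun y hy => ?_
        have h := Ideal.mul_mem_mul (a.2 y.1) (hx y.2)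
        rw [mul_left_comm, ← Finset.prod_mul_distrib] at h
        have hα : y.1 + y.2 = α := Finset.HasAntidiagonal.mem_antidiagonal.mp hy
        subst hα
        simpa only [Finsupp.add_apply, pow_add] using h }
  have hQ : fiberIdeal M I ≤ Q := by
    refine Ideal.map_le_iff_le_comap.2 fun x hx α => ?_
    change coeff α (C x) ∈ _
    rw [coeff_C]
    split_ifs with h
    · subst h
      simpa [-Ideal.one_eq_top] using hx
    · exact Ideal.zero_mem _
  exact hQ hg α

variable (K : Type*) [Field K] {c n k : ℕ} {t : Fin k → ℕ}

theorem val_aeval_reesGenerator (f : MvPolynomial (YVar c n t) K) :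
    (aeval (reesGenerator K (t := t) (c := c) (n := n)) f).1 = toricMap K c n t f := by
  have : ((multiRees fun i => chainIdeal K c n (t i)).val.restrictScalars K).comp
      (aeval (reesGenerator K (t := t) (c := c) (n := n))) = toricMap K c n t := by
    ext y
    simp [toricMap, reesGenerator]
  exact DFunLike.congr_fun this f

theorem Psi_apply (f : MvPolynomial (YVar c n t) K) :
    Psi K c n t f = Ideal.Quotient.mk _ (aeval (reesGenerator K) f) := by
  have : (Ideal.Quotient.mkₐ K _).comp (aeval (reesGenerator K (t := t) (c := c) (n := n))) =
      Psi K c n t := by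
    ext y
    simp [Psi]
  exact (DFunLike.congr_fun this f).symm

theorem chainIdeal_le (s : ℕ) : chainIdeal K c n s ≤ idealOfVars (Fin n) K ^ s := by
  refine Ideal.span_le.2 ?_
  rintro _ ⟨a, rfl⟩
  have : chainMonomial K a ∈ ∏ _i : Fin s, idealOfVars (Fin n) K :=
    Ideal.prod_mem_prod fun i _ => Ideal.subset_span ⟨a.1 i, rfl⟩
  simpa using this

theorem degree_multidegree (u : YVar c n t →₀ ℕ) :
    (multidegree u).2.degree = ∑ i, t i * (multidegree u).1 i := by
  obtain ⟨d, p, rfl⟩ := exists_sum_single_eq u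
  rw [multidegree_sum_single]
  simp only [map_sum, degree_chainExponent, Finsupp.finsetSum_apply, Finset.mul_sum]
  rw [Finset.sum_comm]
  refine Finset.sum_congr rfl fun e _ => ?_
  rw [Finset.sum_eq_single (p e).1]
  · simp
  · intro i _ hi
    rw [Finsupp.single_eq_of_ne hi, mul_zero]
  · simp

/-- The coefficient of `T^α` of an element of `m_R Rees` has only terms of degree greater than
`∑ t_i α_i`, whereas that of a polynomial in the generators has only terms of this degree. -/
theorem ker_Psi : RingHom.ker (Psi K c n t) = toricIdeal K c n t := by
  rw [toricIdeal_eq_ker]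
  ext f
  rw [RingHom.mem_ker, RingHom.mem_ker, Psi_apply, Ideal.Quotient.eq_zero_iff_mem]
  constructor
  · intro hf
    ext α β
    rw [coeff_zero, coeff_zero]
    have h1 := coeff_mem_of_mem_fiberIdeal hf α
    rw [val_aeval_reesGenerator] at h1
    have h2 : idealOfVars (Fin n) K * ∏ i, chainIdeal K c n (t i) ^ α i ≤
        idealOfVars (Fin n) K ^ (1 + ∑ i, t i * α i) := by
      rw [pow_add, pow_one, ← Finset.prod_pow_eq_pow_sum]
      simp only [pow_mul]
      exact Ideal.mul_mono_right
        (Finset.prod_le_prod' fun i _ => Ideal.pow_right_mono (chainIdeal_le K _) _)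
    have h3 := (mem_pow_idealOfVars_iff' _ _).1 (h2 h1) β
    by_cases hdeg : β.degree = ∑ i, t i * α i
    · exact h3 (by omega)
    · rw [coeff_coeff_toricMap]
      refine Finset.sum_eq_zero fun u hu => absurd ?_ hdeg
      have := degree_multidegree u
      rwa [(Finset.mem_filter.1 hu).2] at this
  · intro hf
    have : aeval (reesGenerator K (t := t) (c := c) (n := n)) f = 0 :=
      Subtype.ext ((val_aeval_reesGenerator K f).trans hf)
    rw [this]
    exact Ideal.zero_mem _

/-- A subalgebra that contains `I_i T_i` for all `i` contains all terms of elements of the Rees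
algebra. -/
theorem monomial_mem_of_mem_prod {R : Type*} [CommRing R] {k : ℕ} {I : Fin k → Ideal R}
    {S : Subalgebra R (MvPolynomial (Fin k) R)}
    (hS : ∀ i, ∀ r ∈ I i, monomial (Finsupp.single i 1) r ∈ S) (α : Fin k →₀ ℕ) :
    ∀ r ∈ ∏ i, I i ^ α i, monomial α r ∈ S := by
  -- the coefficients that are allowed at `T^α` form an ideal
  let A : (Fin k →₀ ℕ) → Ideal R := fun α => S.toSubmodule.comap (monomial α)
  have hmul : ∀ α β, A α * A β ≤ A (α + β) := by
    intro α β
    refine Ideal.mul_le.2 fun r hr s hs => ?_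
    have := S.mul_mem hr hs
    rw [monomial_mul] at this
    exact this
  have hzero : A 0 = ⊤ := (Ideal.eq_top_iff_one _).2 (by
    change monomial 0 1 ∈ S
    exact S.one_mem)
  have key : ∏ i, I i ^ α i ≤ A α := by
    induction α using Finsupp.induction_linear with
    | zero => simp [hzero]
    | add u v hu hv =>
      refine le_trans (le_of_eq ?_) ((Ideal.mul_mono hu hv).trans (hmul u v))
      rw [← Finset.prod_mul_distrib]
      simp [pow_add]
    | single i m =>
      rw [Finset.prod_eq_single i]
      · rw [Finsupp.single_eq_same]
        induction m with
        | zero => simp [hzero]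
        | succ m ih =>
          rw [pow_succ, Finsupp.single_add]
          exact (Ideal.mul_mono ih fun r hr => hS i r hr).trans (hmul _ _)
      · intro j _ hj
        rw [Finsupp.single_eq_of_ne hj, pow_zero]
      · simp
  exact key

/-- The Rees algebra is generated over `R` by the elements `x_a T_i`, and `R` is replaced by `K`
modulo `m_R`. -/
theorem Psi_surjective : Function.Surjective (Psi K c n t) := by
  let M : Ideal (MvPolynomial (Fin n) K) := idealOfVars (Fin n) K
  let I : Fin k → Ideal (MvPolynomial (Fin n) K) := fun i => chainIdeal K c n (t i)
  let q : multiRees I →+* SpecialFiber K c n t := Ideal.Quotient.mk (fiberIdeal M I)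
  -- modulo `m_R` only the constant terms of the coefficients matter
  let B : Subalgebra (MvPolynomial (Fin n) K) (multiRees I) :=
    { carrier := {g | q g ∈ (Psi K c n t).range}
      mul_mem' := fun {a b} ha hb => by
        change q (a * b) ∈ (Psi K c n t).range
        rw [map_mul]
        exact mul_mem ha hb
      add_mem' := fun {a b} ha hb => by
        change q (a + b) ∈ (Psi K c n t).range
        rw [map_add]
        exact add_mem ha hb
      algebraMap_mem' := fun r => by
        have h1 : r - C (constantCoeff r) ∈ M := by
          have := (mem_pow_idealOfVars_iff' 1 (r - C (constantCoeff r))).2 fun x hx => by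
            obtain rfl : x = 0 := by
              rw [← Finsupp.degree_eq_zero_iff]
              omega
            rw [coeff_sub, coeff_C, if_pos rfl, constantCoeff_eq, sub_self]
          rwa [pow_one] at this
        have h2 := Ideal.mem_map_of_mem (algebraMap _ (multiRees I)) h1
        rw [map_sub] at h2
        have h3 : q (algebraMap _ (multiRees I) r) =
            q (algebraMap _ (multiRees I) (C (constantCoeff r))) := Ideal.Quotient.eq.2 h2
        change q (algebraMap _ (multiRees I) r) ∈ (Psi K c n t).range
        rw [h3]
        exact (Psi K c n t).range.algebraMap_mem (constantCoeff r) }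
  have hgen : ∀ y : YVar c n t, reesGenerator K y ∈ B := fun y =>
    ⟨X y, by
      change Psi K c n t (X y) = _
      rw [Psi_apply, aeval_X]⟩
  have hB : ∀ g : multiRees I, g.1 ∈ B.map (Subalgebra.val _) := by
    intro g
    rw [g.1.as_sum]
    refine Subalgebra.sum_mem _ fun α _ => monomial_mem_of_mem_prod (fun i r hr => ?_) α _ (g.2 α)
    have hle : I i ≤ ((B.map (Subalgebra.val _)).toSubmodule.comap
        (monomial (Finsupp.single i 1)) : Ideal _) := by
      refine Ideal.span_le.2 ?_
      rintro _ ⟨a, rfl⟩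
      exact ⟨reesGenerator K ⟨i, a⟩, hgen ⟨i, a⟩, rfl⟩
    exact hle hr
  intro z
  obtain ⟨g, rfl⟩ := Ideal.Quotient.mk_surjective z
  obtain ⟨g', hg', he⟩ := hB g
  obtain rfl : g' = g := Subtype.ext he
  exact hg'

end SpecialFiber

/-! ### The Gröbner basis -/

section GroebnerBasis

variable (K : Type*) [Field K] (c n : ℕ) {k : ℕ} (t : Fin k → ℕ)

/-- The quadratic monomials whose factors do not form a quasi-sorted pair in either order. -/
def unsortedPairs : Set (YVar c n t →₀ ℕ) :=
  {w | ∃ y z, w = Finsupp.single y 1 + Finsupp.single z 1 ∧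
    ¬ QuasiSortedRel y z ∧ ¬ QuasiSortedRel z y}

variable {c n t}

theorem quasiSortedMonomial_iff (u : YVar c n t →₀ ℕ) :
    QuasiSortedMonomial u ↔ ∀ w ∈ unsortedPairs c n t, ¬ w ≤ u := by
  constructor
  · rintro hu _ ⟨y, z, rfl, h, h'⟩ hle
    exact (hu.rel_or_rel hle).elim h h'
  · intro h
    refine quasiSortedMonomial_of_pairs fun y z hle => ?_
    by_contra! hcon
    exact h _ ⟨y, z, rfl, hcon⟩ hle

theorem degree_of_mem_unsortedPairs {w : YVar c n t →₀ ℕ} (hw : w ∈ unsortedPairs c n t) :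
    w.degree = 2 := by
  obtain ⟨y, z, rfl, -⟩ := hw
  simp

theorem squarefree_of_mem_unsortedPairs {w : YVar c n t →₀ ℕ} (hw : w ∈ unsortedPairs c n t)
    (x : YVar c n t) : w x ≤ 1 := by
  classical
  obtain ⟨y, z, rfl, h, -⟩ := hw
  have hyz : y ≠ z := by
    rintro rfl
    exact h (QuasiSortedRel.refl y)
  rw [Finsupp.add_apply, Finsupp.single_apply, Finsupp.single_apply]
  split_ifs with h1 h2 <;> first | omega | exact absurd (h1.trans h2.symm) hyz

theorem exists_lt_of_mem_unsortedPairs {w : YVar c n t →₀ ℕ} (hw : w ∈ unsortedPairs c n t) :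
    ∃ v, multidegree v = multidegree w ∧
      (tableOrder c n t).toSyn v < (tableOrder c n t).toSyn w := by
  obtain ⟨y, z, rfl, h, h'⟩ := hw
  exact exists_lt_of_not_rel le_rfl h h'

theorem degree_monomial_sub_monomial {σ : Type*} (m : MonomialOrder σ) {u v : σ →₀ ℕ}
    (h : m.toSyn v < m.toSyn u) : m.degree (monomial u (1 : K) - monomial v 1) = u := by
  classical
  have hu : m.degree (monomial u (1 : K)) = u := by
    rw [m.degree_monomial, if_neg one_ne_zero]
  have hv : m.degree (monomial v (1 : K)) = v := by
    rw [m.degree_monomial, if_neg one_ne_zero]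
  rw [m.degree_sub_of_lt (by rwa [hu, hv]), hu]

theorem degree_of_multidegree_eq {u v : YVar c n t →₀ ℕ} (h : multidegree u = multidegree v) :
    u.degree = v.degree := by
  obtain ⟨d, p, rfl⟩ := exists_sum_single_eq u
  obtain ⟨d', q, rfl⟩ := exists_sum_single_eq v
  obtain rfl := length_eq_of_multidegree_eq h
  simp

/-- The leading monomial of an element of the toric ideal is not quasi-sorted: the coefficients of
the monomials of its multidegree add up to zero, so another, smaller monomial occurs. -/
theorem not_quasiSortedMonomial_degree {f : MvPolynomial (YVar c n t) K}
    (hf : f ∈ toricIdeal K c n t) (h0 : f ≠ 0) :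
    ¬ QuasiSortedMonomial ((tableOrder c n t).degree f) := by
  set m := tableOrder c n t
  set u := m.degree f with hu
  intro hqs
  have hmem : u ∈ f.support := m.degree_mem_support h0
  rw [toricIdeal_eq_ker, RingHom.mem_ker] at hf
  have h1 := coeff_coeff_toricMap K f (multidegree u).1 (multidegree u).2
  rw [hf, coeff_zero, coeff_zero] at h1
  rw [Finset.sum_eq_single u] at h1
  · exact (mem_support_iff.1 hmem) h1.symm
  · intro v hv hvu
    exfalso
    obtain ⟨hv1, hv2⟩ := Finset.mem_filter.1 hv
    have h2 : m.toSyn v ≤ m.toSyn u := m.le_degree hv1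
    have h3 := hqs.le_of_multidegree_eq hv2
    exact hvu (m.toSyn.injective (le_antisymm h2 h3))
  · intro h
    refine absurd ?_ h
    rw [Finset.mem_filter]
    exact ⟨hmem, rfl⟩

theorem initialIdeal_toricIdeal :
    initialIdeal (tableOrder c n t) (toricIdeal K c n t) =
      Ideal.span ((fun u => monomial u (1 : K)) '' unsortedPairs c n t) := by
  refine le_antisymm (Ideal.span_le.2 ?_) (Ideal.span_le.2 ?_)
  · rintro _ ⟨f, hf, h0, rfl⟩
    have h := not_quasiSortedMonomial_degree K hf h0
    rw [quasiSortedMonomial_iff] at h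
    push Not at h
    obtain ⟨w, hw, hle⟩ := h
    obtain ⟨v, hv⟩ := exists_add_of_le hle
    have hmul : monomial (w + v) (1 : K) = monomial w 1 * monomial v 1 := by
      rw [monomial_mul, one_mul]
    rw [hv, hmul]
    exact Ideal.mul_mem_right _ _ (Ideal.subset_span ⟨w, hw, rfl⟩)
  · rintro _ ⟨w, hw, rfl⟩
    obtain ⟨v, hv, hlt⟩ := exists_lt_of_mem_unsortedPairs hw
    have hdeg := degree_monomial_sub_monomial K (tableOrder c n t) hlt
    refine Ideal.subset_span ⟨monomial w 1 - monomial v 1,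
      monomial_sub_monomial_mem_toricIdeal K hv.symm, ?_, by rw [hdeg]⟩
    rw [Ne, sub_eq_zero, (monomial_left_injective (one_ne_zero (α := K))).eq_iff]
    rintro rfl
    exact lt_irrefl _ hlt

theorem isStandard_iff (u : YVar c n t →₀ ℕ) :
    IsStandard (tableOrder c n t) (toricIdeal K c n t) u ↔ QuasiSortedMonomial u := by
  classical
  rw [IsStandard, initialIdeal_toricIdeal, mem_ideal_span_monomial_image, quasiSortedMonomial_iff,
    support_monomial, if_neg one_ne_zero]
  simp

theorem finite_unsortedPairs : (unsortedPairs c n t).Finite := by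
  refine (Set.finite_range fun p : YVar c n t × YVar c n t =>
    (Finsupp.single p.1 1 + Finsupp.single p.2 1 : YVar c n t →₀ ℕ)).subset ?_
  rintro _ ⟨y, z, rfl, -⟩
  exact ⟨(y, z), rfl⟩

theorem exists_isGroebnerBasis :
    ∃ G : Finset (MvPolynomial (YVar c n t) K), (∀ g ∈ G, g.IsHomogeneous 2) ∧
      IsGroebnerBasis (tableOrder c n t) (toricIdeal K c n t) G := by
  classical
  choose! v hv hlt using fun (w : YVar c n t →₀ ℕ) (hw : w ∈ unsortedPairs c n t) =>
    exists_lt_of_mem_unsortedPairs hw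
  let b : (YVar c n t →₀ ℕ) → MvPolynomial (YVar c n t) K := fun w =>
    monomial w 1 - monomial (v w) 1
  have hdeg : ∀ w ∈ unsortedPairs c n t, (tableOrder c n t).degree (b w) = w := fun w hw =>
    degree_monomial_sub_monomial K _ (hlt w hw)
  refine ⟨finite_unsortedPairs.toFinset.image b, ?_, ?_, ?_⟩
  · intro g hg
    obtain ⟨w, hw, rfl⟩ := Finset.mem_image.1 hg
    rw [Set.Finite.mem_toFinset] at hw
    have h2 := degree_of_mem_unsortedPairs hw
    exact (isHomogeneous_monomial 1 h2).sub
      (isHomogeneous_monomial 1 ((degree_of_multidegree_eq (hv w hw)).trans h2))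
  · intro g hg
    obtain ⟨w, hw, rfl⟩ := Finset.mem_image.1 hg
    rw [Set.Finite.mem_toFinset] at hw
    refine ⟨monomial_sub_monomial_mem_toricIdeal K (hv w hw).symm, ?_⟩
    rw [Ne, sub_eq_zero, (monomial_left_injective (one_ne_zero (α := K))).eq_iff]
    intro h
    have := hlt w hw
    rw [← h] at this
    exact lt_irrefl _ this
  · rw [initialIdeal_toricIdeal]
    congr 1
    ext h
    constructor
    · rintro ⟨w, hw, rfl⟩
      exact ⟨b w, Finset.mem_image_of_mem b (finite_unsortedPairs.mem_toFinset.2 hw),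
        by rw [hdeg w hw]⟩
    · rintro ⟨g, hg, rfl⟩
      obtain ⟨w, hw, rfl⟩ := Finset.mem_image.1 hg
      rw [Set.Finite.mem_toFinset] at hw
      exact ⟨w, hw, by rw [hdeg w hw]⟩

end GroebnerBasis

end QuasiSorted

theorem mainTheorem7 (K : Type*) [Field K] (c n k : ℕ) (hc : 1 ≤ c) (t : Fin k → ℕ)
    (ht : ∀ i, 1 ≤ t i ∧ t i ≤ (n + c) / (c + 1)) :
    -- the toric ideal is the defining ideal of the special fiber
    Function.Surjective (QuasiSorted.Psi K c n t) ∧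
    RingHom.ker (QuasiSorted.Psi K c n t) = QuasiSorted.toricIdeal K c n t ∧
    ∃ m : MonomialOrder.{0, 0} (QuasiSorted.YVar c n t),
      -- the standard monomials are exactly the quasi-sorted monomials
      (∀ u : QuasiSorted.YVar c n t →₀ ℕ,
        QuasiSorted.IsStandard m (QuasiSorted.toricIdeal K c n t) u ↔
          QuasiSorted.QuasiSortedMonomial u) ∧
      -- the initial ideal is generated by squarefree quadratic monomials
      (∃ S : Set (QuasiSorted.YVar c n t →₀ ℕ),
        (∀ u ∈ S, u.degree = 2 ∧ ∀ y, u y ≤ 1) ∧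
        QuasiSorted.initialIdeal m (QuasiSorted.toricIdeal K c n t) =
          Ideal.span ((fun u => MvPolynomial.monomial u (1 : K)) '' S)) ∧
      -- the toric ideal has a Gröbner basis of quadrics
      (∃ G : Finset (MvPolynomial (QuasiSorted.YVar c n t) K),
        (∀ g ∈ G, g.IsHomogeneous 2) ∧
        QuasiSorted.IsGroebnerBasis m (QuasiSorted.toricIdeal K c n t) G) :=
  ⟨QuasiSorted.Psi_surjective K, QuasiSorted.ker_Psi K, QuasiSorted.tableOrder c n t,
    QuasiSorted.isStandard_iff K,
    ⟨QuasiSorted.unsortedPairs c n t,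
      fun _ hu => ⟨QuasiSorted.degree_of_mem_unsortedPairs hu,
        QuasiSorted.squarefree_of_mem_unsortedPairs hu⟩,
      QuasiSorted.initialIdeal_toricIdeal K⟩,
    QuasiSorted.exists_isGroebnerBasis K⟩
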